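/- **Setting.** Let $g,m,\ell>0$ and $\sigma\ge 0$. Let $P_\pm,\varepsilon_\pm,\delta_\pm\in C^\infty((0,\infty))$ with $P_\pm>0$ strictly increasing, $1/P_\pm'\in L^\infty_{loc}((0,\infty))$, $\varepsilon_\pm>0$ and $\delta_\pm\ge 0$. Put $h_\pm(z)=\int_1^z P_\pm'(r)r^{-1}\,dr$. Let $\rho_0^->0$ satisfy $P_-(\rho_0^-)>P_+(\rho_0^-)$ and $P_-(\rho_0^-)\in P_+((0,\infty))$, let $\rho_0^+=P_+^{-1}(P_-(\rho_0^-))$, and assume $h_-(\rho_0^-)+gm\in h_-((0,\infty))$ and $h_+(\rho_0^+)-g\ell\in h_+((0,\infty))$. Let $\rho_0(x)=h_-^{-1}(h_-(\rho_0^-)-gx)$ for $-m<x<0$ and $\rho_0(x)=h_+^{-1}(h_+(\rho_0^+)-gx)$ for $0<x<\ell$, and $[\![\rho_0]\!]=\rho_0^+-\rho_0^->0$. Write $P'(\rho_0)$, $\varepsilon_0=\varepsilon(\rho_0)$, $\delta_0=\delta(\rho_0)$, using the laws with index $-$ for $x<0$ and those with index $+$ for $x>0$. For $k>0$, $s>0$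 and $\varphi,\psi\in H^1_0((-m,\ell))$ let $$E_k(\varphi,\psi;s)=\frac{\sigma k^2}{2}\psi(0)^2+\frac12\int_{-m}^{\ell}\Big[(s\delta_0+P'(\rho_0)\rho_0)(\psi'+k\varphi)^2-2g\rho_0k\varphi\psi\Big]dx+\frac12\int_{-m}^{\ell}s\varepsilon_0\Big[(\varphi'-k\psi)^2+(\psi'-k\varphi)^2+\tfrac13(\psi'+k\varphi)^2\Big]dx,$$ $$J(\varphi,\psi)=\frac12\int_{-m}^{\ell}\rho_0(\varphi^2+\psi^2)\,dx,\qquad \mu_k(s)=\inf\{E_k(\varphi,\psi;s):\varphi,\psi\in H^1_0((-m,\ell)),\ J(\varphi,\psi)=1\}.$$ Let $|\xi|_c=\sqrt{g[\![\rho_0]\!]/\sigma}$ if $\sigma>0$ and $|\xi|_c=\infty$ if $\sigma=0$. **Proposition.** For every $k\in(0,|\xi|_c)$ there is a unique $s>0$ with $\mu_k(s)<0$ and $s=\sqrt{-\mu_k(s)}$; denote it by $\lambda(k)>0$. The function $\lambda:(0,|\xi|_c)\to(0,\infty)$ is bounded and continuous, and $$\lim_{k\to0^+}\lambda(k)=0,\qquad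 \lim_{k\to|\xi|_c}\lambda(k)=0$$ (the second limit is taken from the left if $\sigma>0$ and is the limit $k\to\infty$ if $\sigma=0$). Consequently the supremum $$\Lambda=\sup\{\lambda(|\xi|):\xi\in\mathbb R^2,\ 0<|\xi|<|\xi|_c\}$$ is positive and attained, and for every $L>0$ with $L>\sqrt{\sigma/(g[\![\rho_0]\!])}$ the supremum $$\Lambda_L=\sup\{\lambda(|\xi|):\xi\in(L^{-1}\mathbb Z)^2,\ 0<|\xi|<|\xi|_c\}$$ is positive and attained. -/

import Mathlib

open MeasureTheory Set Filter Topology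
open scoped ContDiff

namespace RayleighTaylor

/-- Constitutive laws of a viscous compressible barotropic fluid, as functions of the density in
`(0, ∞)`: the pressure `P`, the shear viscosity `visc` and the bulk viscosity `bulk`.
Values at non-positive densities are irrelevant. -/
structure Fluid where
  P : ℝ → ℝ
  visc : ℝ → ℝ
  bulk : ℝ → ℝ
  P_smooth : ContDiffOn ℝ ∞ P (Ioi 0)
  P_pos : ∀ z, 0 < z → 0 < P z
  P_strictMono : StrictMonoOn P (Ioi 0)
  /-- `1 / P'` is locally bounded on `(0, ∞)`. -/
  P_deriv_lower : ∀ K : Set ℝ, IsCompact K → K ⊆ Ioi 0 → ∃ c, 0 < c ∧ ∀ z ∈ K, c ≤ deriv P z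
  visc_smooth : ContDiffOn ℝ ∞ visc (Ioi 0)
  visc_pos : ∀ z, 0 < z → 0 < visc z
  bulk_smooth : ContDiffOn ℝ ∞ bulk (Ioi 0)
  bulk_nonneg : ∀ z, 0 < z → 0 ≤ bulk z

/-- The enthalpy `h(z) = ∫₁ᶻ P'(r) / r dr`. -/
noncomputable def Fluid.enthalpy (F : Fluid) (z : ℝ) : ℝ := ∫ r in (1 : ℝ)..z, deriv F.P r / r

/-- The inverse of the enthalpy `h : (0, ∞) → h((0, ∞))`. -/
noncomputable def Fluid.enthalpyInv (F : Fluid) : ℝ → ℝ :=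
  Function.invFunOn F.enthalpy (Ioi 0)

/-- The density `P₊⁻¹(P₋(r))` of the upper fluid whose pressure is that of the lower fluid at
density `r`. -/
noncomputable def matchingDensity (lower upper : Fluid) (r : ℝ) : ℝ :=
  Function.invFunOn upper.P (Ioi 0) (lower.P r)

/-- The physical configuration: two fluids in the slab `-m < x₃ < ℓ`, with interface at `x₃ = 0`,
gravity `g > 0`, surface tension `σ ≥ 0`, and the density `rhoMinus` of the lower fluid at the
interface, chosen so that the heavier fluid is on top, and so that the steady state exists on
the whole of `(-m, ℓ)`. -/
structure Configuration where
  lower : Fluid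
  upper : Fluid
  g : ℝ
  σ : ℝ
  m : ℝ
  ℓ : ℝ
  rhoMinus : ℝ
  g_pos : 0 < g
  σ_nonneg : 0 ≤ σ
  m_pos : 0 < m
  ℓ_pos : 0 < ℓ
  rhoMinus_pos : 0 < rhoMinus
  rhoMinus_gt : upper.P rhoMinus < lower.P rhoMinus
  rhoMinus_mem : lower.P rhoMinus ∈ upper.P '' Ioi 0
  m_admissible : lower.enthalpy rhoMinus + g * m ∈ lower.enthalpy '' Ioi 0
  ℓ_admissible :
    upper.enthalpy (matchingDensity lower upper rhoMinus) - g * ℓ ∈ upper.enthalpy '' Ioi 0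

namespace Configuration

variable (C : Configuration)

/-- The density of the upper fluid at the interface. -/
noncomputable def rhoPlus : ℝ := matchingDensity C.lower C.upper C.rhoMinus

/-- The jump of the steady density across the interface. -/
noncomputable def jump : ℝ := C.rhoPlus - C.rhoMinus

/-- The steady density `ρ₀` as a function of `x₃ ∈ (-m, ℓ)`. -/
noncomputable def rho0 (x : ℝ) : ℝ :=
  if x < 0 then C.lower.enthalpyInv (C.lower.enthalpy C.rhoMinus - C.g * x)
  else C.upper.enthalpyInv (C.upper.enthalpy C.rhoPlus - C.g * x)

/-- `P'(ρ₀)`. -/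
noncomputable def dP0 (x : ℝ) : ℝ :=
  if x < 0 then deriv C.lower.P (C.rho0 x) else deriv C.upper.P (C.rho0 x)

/-- The shear viscosity `ε₀ = ε(ρ₀)` of the steady state. -/
noncomputable def visc0 (x : ℝ) : ℝ :=
  if x < 0 then C.lower.visc (C.rho0 x) else C.upper.visc (C.rho0 x)

/-- The bulk viscosity `δ₀ = δ(ρ₀)` of the steady state. -/
noncomputable def bulk0 (x : ℝ) : ℝ :=
  if x < 0 then C.lower.bulk (C.rho0 x) else C.upper.bulk (C.rho0 x)

end Configuration

/-- `u` is (the continuous representative of) an element of `H¹₀((a, b))`: an absolutely continuous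
function on `[a, b]` with square integrable derivative that vanishes at both end points. The weak
derivative of `u` is then its almost everywhere defined classical derivative `deriv u`. -/
def IsH10 (a b : ℝ) (u : ℝ → ℝ) : Prop :=
  AbsolutelyContinuousOnInterval u a b ∧ MemLp (deriv u) 2 (volume.restrict (Ioo a b)) ∧
    u a = 0 ∧ u b = 0

namespace Configuration

variable (C : Configuration)

/-- The energy `E(φ, ψ; s)` at spatial frequency `k = |ξ|`, with modified viscosities `s ε₀` and
`s δ₀`. -/
noncomputable def energy (k s : ℝ) (φ ψ : ℝ → ℝ) : ℝ :=
  C.σ * k ^ 2 / 2 * ψ 0 ^ 2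
  + 1 / 2 * (∫ x in (-C.m)..C.ℓ,
      ((s * C.bulk0 x + C.dP0 x * C.rho0 x) * (deriv ψ x + k * φ x) ^ 2
        - 2 * C.g * C.rho0 x * k * φ x * ψ x))
  + 1 / 2 * (∫ x in (-C.m)..C.ℓ,
      s * C.visc0 x * ((deriv φ x - k * ψ x) ^ 2 + (deriv ψ x - k * φ x) ^ 2
        + 1 / 3 * (deriv ψ x + k * φ x) ^ 2))

/-- The constraint functional `J(φ, ψ)`. -/
noncomputable def J (φ ψ : ℝ → ℝ) : ℝ :=
  1 / 2 * ∫ x in (-C.m)..C.ℓ, C.rho0 x * (φ x ^ 2 + ψ x ^ 2)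

/-- The admissible set `𝒜`: pairs in `H¹₀ × H¹₀` with `J(φ, ψ) = 1`. -/
def admissible : Set ((ℝ → ℝ) × (ℝ → ℝ)) :=
  {p | IsH10 (-C.m) C.ℓ p.1 ∧ IsH10 (-C.m) C.ℓ p.2 ∧ C.J p.1 p.2 = 1}

/-- `μ(s)` at spatial frequency `k`: the infimum of the energy over `𝒜`. -/
noncomputable def mu (k s : ℝ) : ℝ :=
  sInf ((fun p : (ℝ → ℝ) × (ℝ → ℝ) => C.energy k s p.1 p.2) '' C.admissible)

/-- `s > 0` lies in `𝒮 = {μ < 0}` and solves the fixed point equation `s = √(-μ(s))`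
at spatial frequency `k`. -/
def IsGrowthRate (k s : ℝ) : Prop :=
  0 < s ∧ C.mu k s < 0 ∧ s = √(-C.mu k s)

/-- The growth rate `λ(k)`: the solution `s` of `IsGrowthRate k s`. -/
noncomputable def growthRate (k : ℝ) : ℝ := Classical.epsilon (C.IsGrowthRate k)

/-- The critical frequency `|ξ|_c = √(g ⟦ρ₀⟧ / σ)`, to be used for `σ > 0` only; for `σ = 0` the
critical frequency is infinite. -/
noncomputable def criticalFreq : ℝ := √(C.g * C.jump / C.σ)

/-- The interval `(0, |ξ|_c)` of frequencies, which is `(0, ∞)` if `σ = 0`. -/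
def unstableFreqs : Set ℝ := {k | 0 < k ∧ (0 < C.σ → k < C.criticalFreq)}

/-- The values of the growth rate at all unstable spatial frequencies `ξ ∈ ℝ²`. -/
noncomputable def rates : Set ℝ :=
  {r | ∃ ξ : EuclideanSpace ℝ (Fin 2), ‖ξ‖ ∈ C.unstableFreqs ∧ r = C.growthRate ‖ξ‖}

/-- The values of the growth rate at all unstable spatial frequencies in `(L⁻¹ℤ)²`. -/
noncomputable def ratesPeriodic (L : ℝ) : Set ℝ :=
  {r | ∃ ξ : EuclideanSpace ℝ (Fin 2), (∀ i, ∃ n : ℤ, ξ i = L⁻¹ * n) ∧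
    ‖ξ‖ ∈ C.unstableFreqs ∧ r = C.growthRate ‖ξ‖}

/-- The maximal growth rate `Λ` in the non-periodic case. -/
noncomputable def maxRate : ℝ := sSup C.rates

/-- The maximal growth rate `Λ_L` in the `2πL`-periodic case. -/
noncomputable def maxRatePeriodic (L : ℝ) : ℝ := sSup (C.ratesPeriodic L)

end Configuration

end RayleighTaylor

/-! For fixed `k` the energy is affine in the viscosity parameter: `E(s) = E(0) + s V` with `V ≥ 0`.
So `μ` is an infimum of nondecreasing affine functions, hence concave, continuous and nondecreasing
on `(0, ∞)`, and `s² + μ(s)` is strictly increasing. A growth rate is exactly a positive zero of it,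
so uniqueness is immediate and existence needs one sign change.

Hydrostatic balance `ρ₀' = -g ρ₀ / P'(ρ₀)` completes the square in `E(0)`: up to a nonnegative
integral it is `(σ k² - g ⟦ρ₀⟧) ψ(0)² / 2` (`energy_zero_eq`). Below the critical frequency a test
pair that kills the square makes `μ` negative for small `s` (`exists_energy_zero_eq`), while `μ ≥ -g
k` gives the other sign for large `s`.

The same identity, a trace inequality and viscous coercivity yield `μ ≥ B s k² - A (g ⟦ρ₀⟧ - σ k²)²
/ s`. At `s = λ` this bounds `λ³` by `A (g ⟦ρ₀⟧ - σ k²)²` and bounds `λ k`; with `λ² ≤ g k` this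
gives boundedness and the limits at both ends.

Coercivity also makes `μ` continuous in `k` at fixed `s`, which monotonicity in `s` turns into
continuity of `λ`. Sets where `λ` is bounded below then lie in compact sets of unstable frequencies,
so both suprema are attained. -/

namespace RayleighTaylor

/-! ### Functions defined piecewise on the two sides of the interface -/

section Glue

variable {a b : ℝ} {f fl fu fl' fu' : ℝ → ℝ}

theorem absolutelyContinuousOnInterval_of_hasDerivAt (hab : a ≤ b) {f f' : ℝ → ℝ}
    (hf : ∀ x ∈ Icc a b, HasDerivAt f (f' x) x) (hf' : ContinuousOn f' (Icc a b)) :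
    AbsolutelyContinuousOnInterval f a b := by
  obtain ⟨K, hK⟩ := isCompact_Icc.exists_bound_of_continuousOn hf'
  have : LipschitzOnWith K.toNNReal f (Icc a b) :=
    (convex_Icc a b).lipschitzOnWith_of_nnnorm_hasDerivWithin_le
      (fun x hx => (hf x hx).hasDerivWithinAt) fun x hx => by
        rw [← NNReal.coe_le_coe, coe_nnnorm]
        exact (hK x hx).trans (Real.le_coe_toNNReal K)
  rw [← uIcc_of_le hab] at this
  exact this.absolutelyContinuousOnInterval

/-- Two `C¹` functions that agree at `0` glue to a Lipschitz function. -/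
theorem exists_lipschitzOnWith_ite (ha : a ≤ 0) (hb : 0 ≤ b)
    (hl : ∀ x ∈ Icc a 0, HasDerivAt fl (fl' x) x) (hl' : ContinuousOn fl' (Icc a 0))
    (hu : ∀ x ∈ Icc 0 b, HasDerivAt fu (fu' x) x) (hu' : ContinuousOn fu' (Icc 0 b))
    (h0 : fl 0 = fu 0) :
    ∃ K, LipschitzOnWith K (fun x => if x < 0 then fl x else fu x) (Icc a b) := by
  obtain ⟨K₁, hK₁⟩ := isCompact_Icc.exists_bound_of_continuousOn hl'
  obtain ⟨K₂, hK₂⟩ := isCompact_Icc.exists_bound_of_continuousOn hu'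
  have h1 : ∀ x ∈ Icc a 0, ∀ y ∈ Icc a 0, |fl x - fl y| ≤ max K₁ K₂ * |x - y| := fun x hx y hy =>
    ((convex_Icc a 0).norm_image_sub_le_of_norm_hasDerivWithin_le
      (fun x hx => (hl x hx).hasDerivWithinAt) hK₁ hy hx).trans
      (mul_le_mul_of_nonneg_right (le_max_left _ _) (norm_nonneg _))
  have h2 : ∀ x ∈ Icc 0 b, ∀ y ∈ Icc 0 b, |fu x - fu y| ≤ max K₁ K₂ * |x - y| := fun x hx y hy =>
    ((convex_Icc 0 b).norm_image_sub_le_of_norm_hasDerivWithin_le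
      (fun x hx => (hu x hx).hasDerivWithinAt) hK₂ hy hx).trans
      (mul_le_mul_of_nonneg_right (le_max_right _ _) (norm_nonneg _))
  have h3 : ∀ x ∈ Icc a 0, ∀ y ∈ Icc 0 b, |fl x - fu y| ≤ max K₁ K₂ * |x - y| := by
    intro x hx y hy
    have e1 := h1 x hx 0 ⟨ha, le_rfl⟩
    have e2 := h2 0 ⟨le_rfl, hb⟩ y hy
    have e3 : |x - y| = |x - 0| + |0 - y| := by
      rw [abs_of_nonpos (by linarith [hx.2, hy.1]), abs_of_nonpos (by linarith [hx.2]),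
        abs_of_nonpos (by linarith [hy.1])]
      ring
    rw [e3, mul_add]
    calc |fl x - fu y| = |(fl x - fl 0) + (fu 0 - fu y)| := by rw [h0]; ring_nf
      _ ≤ _ := (abs_add_le _ _).trans (add_le_add e1 e2)
  refine ⟨(max K₁ K₂).toNNReal, LipschitzOnWith.of_dist_le_mul fun x hx y hy => ?_⟩
  rw [Real.dist_eq, Real.dist_eq]
  refine le_trans ?_ (mul_le_mul_of_nonneg_right (Real.le_coe_toNNReal _) (abs_nonneg _))
  rcases lt_or_ge x 0 with hx0 | hx0 <;> rcases lt_or_ge y 0 with hy0 | hy0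
  · simp only [hx0, hy0, if_true]
    exact h1 x ⟨hx.1, hx0.le⟩ y ⟨hy.1, hy0.le⟩
  · simp only [hx0, not_lt.2 hy0, if_true, if_false]
    exact h3 x ⟨hx.1, hx0.le⟩ y ⟨hy0, hy.2⟩
  · simp only [hy0, not_lt.2 hx0, if_true, if_false]
    rw [abs_sub_comm, abs_sub_comm x]
    exact h3 y ⟨hy.1, hy0.le⟩ x ⟨hx0, hx.2⟩
  · simp only [not_lt.2 hx0, not_lt.2 hy0, if_false]
    exact h2 x ⟨hx0, hx.2⟩ y ⟨hy0, hy.2⟩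

theorem isH10_ite (ha : a < 0) (hb : 0 < b)
    (hl : ∀ x ∈ Icc a 0, HasDerivAt fl (fl' x) x) (hl' : ContinuousOn fl' (Icc a 0))
    (hu : ∀ x ∈ Icc 0 b, HasDerivAt fu (fu' x) x) (hu' : ContinuousOn fu' (Icc 0 b))
    (h0 : fl 0 = fu 0) (hla : fl a = 0) (hub : fu b = 0) :
    IsH10 a b (fun x => if x < 0 then fl x else fu x) := by
  obtain ⟨K, hK⟩ := exists_lipschitzOnWith_ite ha.le hb.le hl hl' hu hu' h0
  refine ⟨?_, ?_, by simp [ha, hla], by simp [hb.le, hub]⟩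
  · rw [← uIcc_of_le (ha.trans hb).le] at hK
    exact hK.absolutelyContinuousOnInterval
  · refine MemLp.of_bound (measurable_deriv _).aestronglyMeasurable K ?_
    filter_upwards [ae_restrict_mem measurableSet_Ioo] with x hx
    exact norm_deriv_le_of_lipschitzOn (Icc_mem_nhds hx.1 hx.2) hK

theorem deriv_ite_of_neg {x : ℝ} (hx : x < 0) :
    deriv (fun x => if x < 0 then fl x else fu x) x = deriv fl x :=
  EventuallyEq.deriv_eq <| by
    filter_upwards [Iio_mem_nhds hx] with y hy
    simp [mem_Iio.1 hy]

theorem deriv_ite_of_pos {x : ℝ} (hx : 0 < x) :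
    deriv (fun x => if x < 0 then fl x else fu x) x = deriv fu x :=
  EventuallyEq.deriv_eq <| by
    filter_upwards [Ioi_mem_nhds hx] with y hy
    simp [(mem_Ioi.1 hy).le]

/-- Bounded measurable functions on `[a, b]`, the coefficients of the quadratic forms. -/
def IsCoeff (a b : ℝ) (c : ℝ → ℝ) : Prop :=
  AEStronglyMeasurable c (volume.restrict (Ioc a b)) ∧ ∃ M, 0 ≤ M ∧ ∀ x ∈ Icc a b, |c x| ≤ M

theorem isCoeff_ite (ha : a ≤ 0) {c : ℝ → ℝ}
    (hl : ContinuousOn fl (Icc a 0)) (hu : ContinuousOn fu (Icc 0 b))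
    (hcl : ∀ x < 0, c x = fl x) (hcu : ∀ x, 0 ≤ x → c x = fu x) : IsCoeff a b c := by
  constructor
  · have hsub : Ioc a b ⊆ Ico a 0 ∪ Icc 0 b := fun x hx => by
      rcases lt_or_ge x 0 with h | h
      · exact Or.inl ⟨hx.1.le, h⟩
      · exact Or.inr ⟨h, hx.2⟩
    refine AEStronglyMeasurable.mono_measure ?_ (Measure.restrict_mono hsub le_rfl)
    rw [aestronglyMeasurable_union_iff]
    constructor
    · exact ((hl.mono Ico_subset_Icc_self).congr fun x hx => hcl x hx.2).aestronglyMeasurable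
        measurableSet_Ico
    · exact (hu.congr fun x hx => hcu x hx.1).aestronglyMeasurable measurableSet_Icc
  · obtain ⟨K₁, hK₁⟩ := isCompact_Icc.exists_bound_of_continuousOn hl
    obtain ⟨K₂, hK₂⟩ := isCompact_Icc.exists_bound_of_continuousOn hu
    have h1 : 0 ≤ K₁ := (norm_nonneg _).trans (hK₁ 0 ⟨ha, le_rfl⟩)
    refine ⟨max K₁ K₂, h1.trans (le_max_left _ _), fun x hx => ?_⟩
    rcases lt_or_ge x 0 with h | h
    · rw [hcl x h]
      exact (hK₁ x ⟨hx.1, h.le⟩).trans (le_max_left _ _)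
    · rw [hcu x h]
      exact (hK₂ x ⟨h, hx.2⟩).trans (le_max_right _ _)

theorem exists_pos_lower_bound_ite (ha : a ≤ 0) (hb : 0 ≤ b) {c : ℝ → ℝ}
    (hl : ContinuousOn fl (Icc a 0)) (hu : ContinuousOn fu (Icc 0 b))
    (hcl : ∀ x < 0, c x = fl x) (hcu : ∀ x, 0 ≤ x → c x = fu x)
    (hl0 : ∀ x ∈ Icc a 0, 0 < fl x) (hu0 : ∀ x ∈ Icc 0 b, 0 < fu x) :
    ∃ d, 0 < d ∧ ∀ x ∈ Icc a b, d ≤ c x := by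
  obtain ⟨x₁, hx₁, h1⟩ := isCompact_Icc.exists_isMinOn (nonempty_Icc.2 ha) hl
  obtain ⟨x₂, hx₂, h2⟩ := isCompact_Icc.exists_isMinOn (nonempty_Icc.2 hb) hu
  refine ⟨min (fl x₁) (fu x₂), lt_min (hl0 _ hx₁) (hu0 _ hx₂), fun x hx => ?_⟩
  rcases lt_or_ge x 0 with h | h
  · rw [hcl x h]
    exact (min_le_left _ _).trans (h1 (⟨hx.1, h.le⟩ : x ∈ Icc a 0))
  · rw [hcu x h]
    exact (min_le_right _ _).trans (h2 (⟨h, hx.2⟩ : x ∈ Icc 0 b))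

end Glue

/-! ### Enthalpy and the hydrostatic density profile -/

namespace Fluid

variable (F : Fluid)

theorem deriv_P_pos {z : ℝ} (hz : 0 < z) : 0 < deriv F.P z := by
  obtain ⟨c, hc, h⟩ := F.P_deriv_lower {z} isCompact_singleton (by simpa using hz)
  exact hc.trans_le (h z rfl)

theorem continuousOn_deriv_P : ContinuousOn (deriv F.P) (Ioi 0) :=
  F.P_smooth.continuousOn_deriv_of_isOpen isOpen_Ioi (by simp)

theorem hasDerivAt_enthalpy {z : ℝ} (hz : 0 < z) :
    HasDerivAt F.enthalpy (deriv F.P z / z) z := by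
  have hc : ContinuousOn (fun r => deriv F.P r / r) (Ioi 0) :=
    F.continuousOn_deriv_P.div continuousOn_id fun x hx => (mem_Ioi.1 hx).ne'
  have hsub : uIcc 1 z ⊆ Ioi 0 := fun x hx => by
    rw [mem_uIcc] at hx
    rcases hx with hx | hx
    · exact zero_lt_one.trans_le hx.1
    · exact hz.trans_le hx.1
  exact intervalIntegral.integral_hasDerivAt_right (hc.mono hsub).intervalIntegrable
    (hc.stronglyMeasurableAtFilter isOpen_Ioi _ hz) (hc.continuousAt (Ioi_mem_nhds hz))

theorem strictMonoOn_enthalpy : StrictMonoOn F.enthalpy (Ioi 0) := by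
  refine strictMonoOn_of_deriv_pos (convex_Ioi 0)
    (fun x hx => (F.hasDerivAt_enthalpy hx).continuousAt.continuousWithinAt) fun x hx => ?_
  rw [interior_Ioi] at hx
  rw [(F.hasDerivAt_enthalpy hx).deriv]
  exact div_pos (F.deriv_P_pos hx) hx

theorem enthalpyInv_enthalpy {z : ℝ} (hz : 0 < z) : F.enthalpyInv (F.enthalpy z) = z :=
  F.strictMonoOn_enthalpy.injOn.leftInvOn_invFunOn hz

/-- Differentiating a local inverse requires its continuity beforehand; this comes from
monotonicity, because both the image of the enthalpy and the image of its inverse are neighbourhoods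
of the relevant points. -/
theorem hasDerivAt_enthalpyInv {z : ℝ} (hz : 0 < z) :
    HasDerivAt F.enthalpyInv (z / deriv F.P z) (F.enthalpy z) := by
  have himage : F.enthalpy '' Ioi 0 ∈ 𝓝 (F.enthalpy z) := by
    have h1 : z / 2 < z := by linarith
    have h2 : z < 2 * z := by linarith
    have h3 : 0 < z / 2 := by linarith
    have hsub : Icc (z / 2) (2 * z) ⊆ Ioi 0 := fun x hx => h3.trans_le hx.1
    have hc : ContinuousOn F.enthalpy (Icc (z / 2) (2 * z)) := fun x hx =>
      (F.hasDerivAt_enthalpy (hsub hx)).continuousAt.continuousWithinAt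
    refine mem_of_superset (Ioo_mem_nhds (F.strictMonoOn_enthalpy h3 hz h1)
      (F.strictMonoOn_enthalpy hz (hz.trans h2) h2)) ?_
    exact (intermediate_value_Ioo (h1.trans h2).le hc).trans
      (image_mono (Ioo_subset_Icc_self.trans hsub))
  have hmono : StrictMonoOn F.enthalpyInv (F.enthalpy '' Ioi 0) := by
    rintro _ ⟨x, hx, rfl⟩ _ ⟨y, hy, rfl⟩ hxy
    rw [F.enthalpyInv_enthalpy hx, F.enthalpyInv_enthalpy hy]
    exact (F.strictMonoOn_enthalpy.lt_iff_lt hx hy).1 hxy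
  have hcont : ContinuousAt F.enthalpyInv (F.enthalpy z) := by
    refine hmono.continuousAt_of_image_mem_nhds himage ?_
    rw [F.enthalpyInv_enthalpy hz]
    refine mem_of_superset (Ioi_mem_nhds hz) fun x hx => ?_
    exact ⟨_, mem_image_of_mem _ hx, F.enthalpyInv_enthalpy hx⟩
  have hd := F.hasDerivAt_enthalpy hz
  rw [← F.enthalpyInv_enthalpy hz] at hd
  have := HasDerivAt.of_local_left_inverse hcont hd
    (by rw [F.enthalpyInv_enthalpy hz]; exact (div_pos (F.deriv_P_pos hz) hz).ne')
    (by filter_upwards [himage] with y hy using Function.invFunOn_eq hy)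
  rwa [F.enthalpyInv_enthalpy hz, inv_div] at this

/-- The hydrostatic density profile with value `r` at height `0`. -/
noncomputable def profile (g r x : ℝ) : ℝ := F.enthalpyInv (F.enthalpy r - g * x)

theorem profile_zero (g : ℝ) {r : ℝ} (hr : 0 < r) : F.profile g r 0 = r := by
  rw [profile, mul_zero, sub_zero, F.enthalpyInv_enthalpy hr]

/-- The range of the enthalpy is an interval, so admissibility at the two ends `0` and `t` gives it
at every height between. The derivative formula is hydrostatic balance. The sign of `t` is free,
which serves both fluids. -/
theorem profile_spec {g r t : ℝ} (hr : 0 < r) (ht : F.enthalpy r - g * t ∈ F.enthalpy '' Ioi 0)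
    {x : ℝ} (hx : x ∈ uIcc 0 t) : 0 < F.profile g r x ∧
      HasDerivAt (F.profile g r) (-g * F.profile g r x / deriv F.P (F.profile g r x)) x := by
  have hoc : OrdConnected (F.enthalpy '' Ioi 0) :=
    (isPreconnected_Ioi.image _ fun x hx =>
      (F.hasDerivAt_enthalpy hx).continuousAt.continuousWithinAt).ordConnected
  have hmem : F.enthalpy r - g * x ∈ F.enthalpy '' Ioi 0 := by
    refine hoc.uIcc_subset (mem_image_of_mem _ hr) ht ?_
    have : (fun y => F.enthalpy r - g * y) '' uIcc 0 t ⊆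
        uIcc (F.enthalpy r) (F.enthalpy r - g * t) := by
      rintro _ ⟨y, hy, rfl⟩
      rw [mem_uIcc] at hy ⊢
      rcases le_total 0 g with hg | hg <;> rcases hy with hy | hy
      · right; constructor <;> nlinarith
      · left; constructor <;> nlinarith
      · left; constructor <;> nlinarith
      · right; constructor <;> nlinarith
    exact this (mem_image_of_mem _ hx)
  obtain ⟨z, hz, hzx⟩ := hmem
  have hp : F.profile g r x = z := by rw [profile, ← hzx, F.enthalpyInv_enthalpy hz]
  refine ⟨hp ▸ hz, ?_⟩
  rw [hp]
  have h1 := F.hasDerivAt_enthalpyInv hz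
  rw [hzx] at h1
  have h2 : HasDerivAt (fun y => F.enthalpy r - g * y) (-g) x := by
    simpa using ((hasDerivAt_id x).const_mul g).const_sub (F.enthalpy r)
  have h3 : HasDerivAt (F.profile g r) (z / deriv F.P z * -g) x := HasDerivAt.comp x h1 h2
  rwa [show -g * z / deriv F.P z = z / deriv F.P z * -g by ring]

end Fluid

/-! ### Integrability with bounded coefficients and calculus in `H¹₀` -/

namespace IsCoeff

variable {a b : ℝ} {c d f g : ℝ → ℝ}

theorem add (hc : IsCoeff a b c) (hd : IsCoeff a b d) : IsCoeff a b fun x => c x + d x := by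
  obtain ⟨hc, M, hM, hcM⟩ := hc
  obtain ⟨hd, N, hN, hdN⟩ := hd
  exact ⟨hc.add hd, M + N, add_nonneg hM hN, fun x hx =>
    (abs_add_le _ _).trans (add_le_add (hcM x hx) (hdN x hx))⟩

theorem mul (hc : IsCoeff a b c) (hd : IsCoeff a b d) : IsCoeff a b fun x => c x * d x := by
  obtain ⟨hc, M, hM, hcM⟩ := hc
  obtain ⟨hd, N, hN, hdN⟩ := hd
  exact ⟨hc.mul hd, M * N, mul_nonneg hM hN, fun x hx => by
    rw [abs_mul]
    exact mul_le_mul (hcM x hx) (hdN x hx) (abs_nonneg _) hM⟩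

theorem const (a b r : ℝ) : IsCoeff a b fun _ => r :=
  ⟨aestronglyMeasurable_const, |r|, abs_nonneg _, fun _ _ => le_rfl⟩

theorem integrable_mul_mul (hc : IsCoeff a b c) (hf : MemLp f 2 (volume.restrict (Ioc a b)))
    (hg : MemLp g 2 (volume.restrict (Ioc a b))) :
    Integrable (fun x => c x * f x * g x) (volume.restrict (Ioc a b)) := by
  obtain ⟨hc, M, -, hcM⟩ := hc
  have := (hf.integrable_mul hg).bdd_mul (c := M) hc (by
    filter_upwards [ae_restrict_mem measurableSet_Ioc] with x hx
    exact hcM x ⟨hx.1.le, hx.2⟩)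
  simpa [mul_assoc] using this

theorem integrable_mul_sq (hc : IsCoeff a b c) (hf : MemLp f 2 (volume.restrict (Ioc a b))) :
    Integrable (fun x => c x * f x ^ 2) (volume.restrict (Ioc a b)) := by
  simpa only [pow_two, mul_assoc] using hc.integrable_mul_mul hf hf

end IsCoeff

namespace IsH10

variable {a b : ℝ} {u v : ℝ → ℝ}

theorem memLp_deriv (hu : IsH10 a b u) : MemLp (deriv u) 2 (volume.restrict (Ioc a b)) := by
  rw [← Measure.restrict_congr_set Ioo_ae_eq_Ioc]
  exact hu.2.1

theorem memLp (hab : a ≤ b) (hu : IsH10 a b u) : MemLp u 2 (volume.restrict (Ioc a b)) := by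
  have hc := hu.1.continuousOn
  rw [uIcc_of_le hab] at hc
  obtain ⟨K, hK⟩ := isCompact_Icc.exists_bound_of_continuousOn hc
  refine MemLp.of_bound ((hc.mono Ioc_subset_Icc_self).aestronglyMeasurable measurableSet_Ioc) K ?_
  filter_upwards [ae_restrict_mem measurableSet_Ioc] with x hx using hK x (Ioc_subset_Icc_self hx)

theorem const_mul (hu : IsH10 a b u) (c : ℝ) : IsH10 a b fun x => c * u x := by
  refine ⟨hu.1.const_mul c, ?_, by simp [hu.2.2.1], by simp [hu.2.2.2]⟩
  have : deriv (fun x => c * u x) = fun x => c * deriv u x := by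
    ext x
    exact deriv_const_mul_field c
  rw [this]
  exact hu.2.1.const_mul c

theorem integral_deriv_mul_add (hab : a ≤ b) (hu : IsH10 a b u) (hv : IsH10 a b v) :
    ∫ x in Ioc a b, (deriv u x * v x + u x * deriv v x) = 0 := by
  rw [← intervalIntegral.integral_of_le hab, hu.1.integral_deriv_mul_eq_sub hv.1, hu.2.2.1,
    hu.2.2.2]
  simp

/-- The trace inequality at an interior point. -/
theorem sq_le (hu : IsH10 a b u) {x : ℝ} (hx : x ∈ Icc a b) {η : ℝ} (hη : 0 < η) :
    u x ^ 2 ≤ η * (∫ x in Ioc a b, deriv u x ^ 2) + η⁻¹ * ∫ x in Ioc a b, u x ^ 2 := by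
  have hab := hx.1.trans hx.2
  have hac : AbsolutelyContinuousOnInterval u a x := hu.1.mono <| by
    rw [uIcc_of_le hab, uIcc_of_le hx.1]
    exact Icc_subset_Icc_right hx.2
  have h1 := hac.integral_deriv_mul_eq_sub hac
  rw [hu.2.2.1, intervalIntegral.integral_of_le hx.1] at h1
  have hi : Integrable (fun x => η * deriv u x ^ 2 + η⁻¹ * u x ^ 2)
      (volume.restrict (Ioc a b)) :=
    (hu.memLp_deriv.integrable_sq.const_mul _).add ((hu.memLp hab).integrable_sq.const_mul _)
  have hi2 : Integrable (fun x => deriv u x * u x + u x * deriv u x)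
      (volume.restrict (Ioc a b)) :=
    (hu.memLp_deriv.integrable_mul (hu.memLp hab)).add
      ((hu.memLp hab).integrable_mul hu.memLp_deriv)
  have hsub : Ioc a x ⊆ Ioc a b := Ioc_subset_Ioc_right hx.2
  calc u x ^ 2 = ∫ y in Ioc a x, (deriv u y * u y + u y * deriv u y) := by rw [h1]; ring
    _ ≤ ∫ y in Ioc a x, (η * deriv u y ^ 2 + η⁻¹ * u y ^ 2) := by
        refine integral_mono (hi2.mono_measure (Measure.restrict_mono hsub le_rfl))
          (hi.mono_measure (Measure.restrict_mono hsub le_rfl)) fun y => ?_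
        -- The defect in Young's inequality for `(u²)' = 2 u u'` is a square.
        have e : η * deriv u y ^ 2 + η⁻¹ * u y ^ 2 - (deriv u y * u y + u y * deriv u y) =
            η⁻¹ * (η * deriv u y - u y) ^ 2 := by
          field_simp
          ring
        have : 0 ≤ η⁻¹ * (η * deriv u y - u y) ^ 2 := by positivity
        simp only
        linarith
    _ ≤ ∫ y in Ioc a b, (η * deriv u y ^ 2 + η⁻¹ * u y ^ 2) :=
        setIntegral_mono_set hi (ae_of_all _ fun y => by positivity) (ae_of_all _ hsub)
    _ = _ := by
        rw [integral_add (hu.memLp_deriv.integrable_sq.const_mul _)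
          ((hu.memLp hab).integrable_sq.const_mul _), integral_const_mul, integral_const_mul]

end IsH10

/-! ### The steady state and bounds for its coefficients -/

namespace Configuration

variable (C : Configuration)

theorem rhoPlus_pos : 0 < C.rhoPlus := Function.invFunOn_mem C.rhoMinus_mem

theorem P_rhoPlus : C.upper.P C.rhoPlus = C.lower.P C.rhoMinus :=
  Function.invFunOn_eq C.rhoMinus_mem

theorem jump_pos : 0 < C.jump := by
  have h := C.rhoMinus_gt
  rw [← C.P_rhoPlus] at h
  exact sub_pos.2 ((C.upper.P_strictMono.lt_iff_lt C.rhoMinus_pos C.rhoPlus_pos).1 h)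

/-- The density profile of the lower fluid, extended beyond the interface. -/
noncomputable def rhoLower : ℝ → ℝ := C.lower.profile C.g C.rhoMinus

/-- The density profile of the upper fluid, extended beyond the interface. -/
noncomputable def rhoUpper : ℝ → ℝ := C.upper.profile C.g C.rhoPlus

theorem rho0_of_neg {x : ℝ} (hx : x < 0) : C.rho0 x = C.rhoLower x := if_pos hx

theorem rho0_of_nonneg {x : ℝ} (hx : 0 ≤ x) : C.rho0 x = C.rhoUpper x := if_neg hx.not_gt

theorem rhoLower_zero : C.rhoLower 0 = C.rhoMinus := C.lower.profile_zero _ C.rhoMinus_pos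

theorem rhoUpper_zero : C.rhoUpper 0 = C.rhoPlus := C.upper.profile_zero _ C.rhoPlus_pos

theorem rhoLower_spec {x : ℝ} (hx : x ∈ Icc (-C.m) 0) : 0 < C.rhoLower x ∧
    HasDerivAt C.rhoLower (-C.g * C.rhoLower x / deriv C.lower.P (C.rhoLower x)) x := by
  refine C.lower.profile_spec (t := -C.m) C.rhoMinus_pos ?_ ?_
  · simpa using C.m_admissible
  · rwa [uIcc_of_ge (by linarith [C.m_pos])]

theorem rhoUpper_spec {x : ℝ} (hx : x ∈ Icc 0 C.ℓ) : 0 < C.rhoUpper x ∧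
    HasDerivAt C.rhoUpper (-C.g * C.rhoUpper x / deriv C.upper.P (C.rhoUpper x)) x := by
  refine C.upper.profile_spec (t := C.ℓ) C.rhoPlus_pos C.ℓ_admissible ?_
  rwa [uIcc_of_le C.ℓ_pos.le]

theorem continuousOn_comp_rhoLower {G : ℝ → ℝ} (hG : ContinuousOn G (Ioi 0)) :
    ContinuousOn (fun x => G (C.rhoLower x)) (Icc (-C.m) 0) :=
  hG.comp (fun _ hx => (C.rhoLower_spec hx).2.continuousAt.continuousWithinAt)
    fun _ hx => (C.rhoLower_spec hx).1

theorem continuousOn_comp_rhoUpper {G : ℝ → ℝ} (hG : ContinuousOn G (Ioi 0)) :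
    ContinuousOn (fun x => G (C.rhoUpper x)) (Icc 0 C.ℓ) :=
  hG.comp (fun _ hx => (C.rhoUpper_spec hx).2.continuousAt.continuousWithinAt)
    fun _ hx => (C.rhoUpper_spec hx).1

theorem neg_m_le : -C.m ≤ 0 := by linarith [C.m_pos]

theorem neg_m_le_ℓ : -C.m ≤ C.ℓ := by linarith [C.m_pos, C.ℓ_pos]

/-- A coefficient built from a law for each fluid. -/
noncomputable def coeff (Gl Gu : ℝ → ℝ) (x : ℝ) : ℝ :=
  if x < 0 then Gl (C.rho0 x) else Gu (C.rho0 x)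

section Coeff

variable {Gl Gu : ℝ → ℝ}

theorem coeff_of_neg {x : ℝ} (hx : x < 0) : C.coeff Gl Gu x = Gl (C.rhoLower x) := by
  rw [coeff, if_pos hx, C.rho0_of_neg hx]

theorem coeff_of_nonneg {x : ℝ} (hx : 0 ≤ x) : C.coeff Gl Gu x = Gu (C.rhoUpper x) := by
  rw [coeff, if_neg hx.not_gt, C.rho0_of_nonneg hx]

theorem isCoeff_coeff (hl : ContinuousOn Gl (Ioi 0)) (hu : ContinuousOn Gu (Ioi 0)) :
    IsCoeff (-C.m) C.ℓ (C.coeff Gl Gu) :=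
  isCoeff_ite C.neg_m_le (C.continuousOn_comp_rhoLower hl)
    (C.continuousOn_comp_rhoUpper hu) (fun _ hx => C.coeff_of_neg hx)
    fun _ hx => C.coeff_of_nonneg hx

theorem exists_pos_le_coeff (hl : ContinuousOn Gl (Ioi 0)) (hu : ContinuousOn Gu (Ioi 0))
    (hl0 : ∀ z, 0 < z → 0 < Gl z) (hu0 : ∀ z, 0 < z → 0 < Gu z) :
    ∃ d, 0 < d ∧ ∀ x ∈ Icc (-C.m) C.ℓ, d ≤ C.coeff Gl Gu x :=
  exists_pos_lower_bound_ite C.neg_m_le C.ℓ_pos.le (C.continuousOn_comp_rhoLower hl)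
    (C.continuousOn_comp_rhoUpper hu) (fun _ hx => C.coeff_of_neg hx)
    (fun _ hx => C.coeff_of_nonneg hx) (fun _ hx => hl0 _ (C.rhoLower_spec hx).1)
    (fun _ hx => hu0 _ (C.rhoUpper_spec hx).1)

end Coeff

theorem rho0_eq_coeff : C.rho0 = C.coeff id id := by
  ext x
  simp [coeff]

theorem isCoeff_rho0 : IsCoeff (-C.m) C.ℓ C.rho0 := by
  rw [C.rho0_eq_coeff]
  exact C.isCoeff_coeff continuousOn_id continuousOn_id

theorem isCoeff_dP0 : IsCoeff (-C.m) C.ℓ C.dP0 :=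
  C.isCoeff_coeff C.lower.continuousOn_deriv_P C.upper.continuousOn_deriv_P

theorem isCoeff_inv_dP0 : IsCoeff (-C.m) C.ℓ fun x => (C.dP0 x)⁻¹ := by
  have := C.isCoeff_coeff
    (C.lower.continuousOn_deriv_P.inv₀ fun _ hx => (C.lower.deriv_P_pos hx).ne')
    (C.upper.continuousOn_deriv_P.inv₀ fun _ hx => (C.upper.deriv_P_pos hx).ne')
  convert this using 1
  ext x
  simp only [dP0, coeff]
  split_ifs <;> rfl

theorem isCoeff_visc0 : IsCoeff (-C.m) C.ℓ C.visc0 :=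
  C.isCoeff_coeff C.lower.visc_smooth.continuousOn C.upper.visc_smooth.continuousOn

theorem isCoeff_bulk0 : IsCoeff (-C.m) C.ℓ C.bulk0 :=
  C.isCoeff_coeff C.lower.bulk_smooth.continuousOn C.upper.bulk_smooth.continuousOn

theorem exists_pos_le_rho0 : ∃ d, 0 < d ∧ ∀ x ∈ Icc (-C.m) C.ℓ, d ≤ C.rho0 x := by
  rw [C.rho0_eq_coeff]
  exact C.exists_pos_le_coeff continuousOn_id continuousOn_id (fun _ h => h) fun _ h => h

theorem exists_pos_le_visc0 : ∃ d, 0 < d ∧ ∀ x ∈ Icc (-C.m) C.ℓ, d ≤ C.visc0 x :=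
  C.exists_pos_le_coeff C.lower.visc_smooth.continuousOn C.upper.visc_smooth.continuousOn
    C.lower.visc_pos C.upper.visc_pos

theorem rho0_pos {x : ℝ} (hx : x ∈ Icc (-C.m) C.ℓ) : 0 < C.rho0 x := by
  obtain ⟨d, hd, h⟩ := C.exists_pos_le_rho0
  exact hd.trans_le (h x hx)

theorem dP0_pos {x : ℝ} (hx : x ∈ Icc (-C.m) C.ℓ) : 0 < C.dP0 x := by
  obtain ⟨d, hd, h⟩ := C.exists_pos_le_coeff C.lower.continuousOn_deriv_P
    C.upper.continuousOn_deriv_P (fun _ => C.lower.deriv_P_pos) (fun _ => C.upper.deriv_P_pos)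
  exact hd.trans_le (h x hx)

theorem visc0_pos {x : ℝ} (hx : x ∈ Icc (-C.m) C.ℓ) : 0 < C.visc0 x := by
  obtain ⟨d, hd, h⟩ := C.exists_pos_le_visc0
  exact hd.trans_le (h x hx)

theorem bulk0_nonneg {x : ℝ} (hx : x ∈ Icc (-C.m) C.ℓ) : 0 ≤ C.bulk0 x := by
  unfold bulk0
  split_ifs with h
  · exact C.lower.bulk_nonneg _ (C.rho0_pos hx)
  · exact C.upper.bulk_nonneg _ (C.rho0_pos hx)

end Configuration

/-! ### Splitting the energy and completing the square -/

namespace Configuration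

variable (C : Configuration)

/-- The viscous dissipation density, without the factor `s`. -/
noncomputable def viscousDensity (k : ℝ) (φ ψ : ℝ → ℝ) (x : ℝ) : ℝ :=
  C.bulk0 x * (deriv ψ x + k * φ x) ^ 2
    + C.visc0 x * ((deriv φ x - k * ψ x) ^ 2 + (deriv ψ x - k * φ x) ^ 2
        + 1 / 3 * (deriv ψ x + k * φ x) ^ 2)

/-- The viscous part of the energy, without the factor `s`. -/
noncomputable def viscousEnergy (k : ℝ) (φ ψ : ℝ → ℝ) : ℝ :=
  1 / 2 * ∫ x in Ioc (-C.m) C.ℓ, C.viscousDensity k φ ψ x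

section Integrable

variable {C} {φ ψ : ℝ → ℝ}

theorem memLp_deriv_add (hφ : IsH10 (-C.m) C.ℓ φ) (hψ : IsH10 (-C.m) C.ℓ ψ) (k : ℝ) :
    MemLp (fun x => deriv ψ x + k * φ x) 2 (volume.restrict (Ioc (-C.m) C.ℓ)) :=
  hψ.memLp_deriv.add ((hφ.memLp C.neg_m_le_ℓ).const_mul k)

theorem memLp_deriv_sub (hφ : IsH10 (-C.m) C.ℓ φ) (hψ : IsH10 (-C.m) C.ℓ ψ) (k : ℝ) :
    MemLp (fun x => deriv ψ x - k * φ x) 2 (volume.restrict (Ioc (-C.m) C.ℓ)) :=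
  hψ.memLp_deriv.sub ((hφ.memLp C.neg_m_le_ℓ).const_mul k)

theorem integrable_pressureDensity (hφ : IsH10 (-C.m) C.ℓ φ) (hψ : IsH10 (-C.m) C.ℓ ψ) (k : ℝ) :
    Integrable (fun x => C.dP0 x * C.rho0 x * (deriv ψ x + k * φ x) ^ 2
      - 2 * C.g * C.rho0 x * k * φ x * ψ x) (volume.restrict (Ioc (-C.m) C.ℓ)) := by
  refine ((C.isCoeff_dP0.mul C.isCoeff_rho0).integrable_mul_sq (memLp_deriv_add hφ hψ k)).sub ?_
  exact ((((IsCoeff.const _ _ (2 * C.g)).mul C.isCoeff_rho0).mul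
    (IsCoeff.const _ _ k)).integrable_mul_mul (hφ.memLp C.neg_m_le_ℓ) (hψ.memLp C.neg_m_le_ℓ))

theorem integrable_shearDensity (hφ : IsH10 (-C.m) C.ℓ φ) (hψ : IsH10 (-C.m) C.ℓ ψ) (k : ℝ) :
    Integrable (fun x => C.visc0 x * ((deriv φ x - k * ψ x) ^ 2 + (deriv ψ x - k * φ x) ^ 2
        + 1 / 3 * (deriv ψ x + k * φ x) ^ 2)) (volume.restrict (Ioc (-C.m) C.ℓ)) := by
  have h1 := C.isCoeff_visc0.integrable_mul_sq (memLp_deriv_sub hψ hφ k)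
  have h2 := C.isCoeff_visc0.integrable_mul_sq (memLp_deriv_sub hφ hψ k)
  have h3 := (C.isCoeff_visc0.integrable_mul_sq (memLp_deriv_add hφ hψ k)).const_mul (1 / 3)
  refine ((h1.add h2).add h3).congr (ae_of_all _ fun x => ?_)
  simp only [Pi.add_apply]
  ring

theorem integrable_bulkDensity (hφ : IsH10 (-C.m) C.ℓ φ) (hψ : IsH10 (-C.m) C.ℓ ψ) (k : ℝ) :
    Integrable (fun x => C.bulk0 x * (deriv ψ x + k * φ x) ^ 2)
      (volume.restrict (Ioc (-C.m) C.ℓ)) :=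
  C.isCoeff_bulk0.integrable_mul_sq (memLp_deriv_add hφ hψ k)

theorem integrable_viscousDensity (hφ : IsH10 (-C.m) C.ℓ φ) (hψ : IsH10 (-C.m) C.ℓ ψ) (k : ℝ) :
    Integrable (C.viscousDensity k φ ψ) (volume.restrict (Ioc (-C.m) C.ℓ)) :=
  (integrable_bulkDensity hφ hψ k).add (integrable_shearDensity hφ hψ k)

theorem energy_eq (hφ : IsH10 (-C.m) C.ℓ φ) (hψ : IsH10 (-C.m) C.ℓ ψ) (k s : ℝ) :
    C.energy k s φ ψ = C.σ * k ^ 2 / 2 * ψ 0 ^ 2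
      + 1 / 2 * (∫ x in Ioc (-C.m) C.ℓ, (C.dP0 x * C.rho0 x * (deriv ψ x + k * φ x) ^ 2
        - 2 * C.g * C.rho0 x * k * φ x * ψ x)) + s * C.viscousEnergy k φ ψ := by
  have hp := integrable_pressureDensity hφ hψ k
  have hs := integrable_shearDensity hφ hψ k
  have hb := integrable_bulkDensity hφ hψ k
  have e1 : ∫ x in (-C.m)..C.ℓ, ((s * C.bulk0 x + C.dP0 x * C.rho0 x) * (deriv ψ x + k * φ x) ^ 2
        - 2 * C.g * C.rho0 x * k * φ x * ψ x) =
      (∫ x in Ioc (-C.m) C.ℓ, (C.dP0 x * C.rho0 x * (deriv ψ x + k * φ x) ^ 2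
        - 2 * C.g * C.rho0 x * k * φ x * ψ x)) +
      s * ∫ x in Ioc (-C.m) C.ℓ, C.bulk0 x * (deriv ψ x + k * φ x) ^ 2 := by
    rw [intervalIntegral.integral_of_le C.neg_m_le_ℓ, ← integral_const_mul,
      ← integral_add hp (hb.const_mul s)]
    congr 1
    ext x
    ring
  have e2 : ∫ x in (-C.m)..C.ℓ,
      s * C.visc0 x * ((deriv φ x - k * ψ x) ^ 2 + (deriv ψ x - k * φ x) ^ 2
        + 1 / 3 * (deriv ψ x + k * φ x) ^ 2) =
      s * ∫ x in Ioc (-C.m) C.ℓ, C.visc0 x * ((deriv φ x - k * ψ x) ^ 2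
        + (deriv ψ x - k * φ x) ^ 2 + 1 / 3 * (deriv ψ x + k * φ x) ^ 2) := by
    rw [intervalIntegral.integral_of_le C.neg_m_le_ℓ, ← integral_const_mul]
    congr 1
    ext x
    ring
  rw [energy, e1, e2, viscousEnergy]
  unfold viscousDensity
  rw [integral_add hb hs]
  ring

theorem energy_eq_add (hφ : IsH10 (-C.m) C.ℓ φ) (hψ : IsH10 (-C.m) C.ℓ ψ) (k s : ℝ) :
    C.energy k s φ ψ = C.energy k 0 φ ψ + s * C.viscousEnergy k φ ψ := by
  rw [energy_eq hφ hψ k s, energy_eq hφ hψ k 0]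
  ring

/-- By hydrostatic balance the integrand is `(ρ₀ ψ²)'` almost everywhere on each side. Since `ρ₀`
jumps at `0`, the fundamental theorem is applied to each smooth branch separately; the outer
boundary terms vanish and the jump remains. -/
theorem integral_rho0_mul (hψ : IsH10 (-C.m) C.ℓ ψ) :
    ∫ x in Ioc (-C.m) C.ℓ, C.rho0 x * (2 * ψ x * deriv ψ x - C.g * (C.dP0 x)⁻¹ * ψ x ^ 2) =
      -C.jump * ψ 0 ^ 2 := by
  have hm := C.neg_m_le
  have hl := C.ℓ_pos.le
  have hi : Integrable
      (fun x => C.rho0 x * (2 * ψ x * deriv ψ x - C.g * (C.dP0 x)⁻¹ * ψ x ^ 2))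
      (volume.restrict (Ioc (-C.m) C.ℓ)) := by
    have h1 := (C.isCoeff_rho0.integrable_mul_mul (hψ.memLp C.neg_m_le_ℓ)
      hψ.memLp_deriv).const_mul 2
    have h2 := ((C.isCoeff_rho0.mul C.isCoeff_inv_dP0).integrable_mul_sq
      (hψ.memLp C.neg_m_le_ℓ)).const_mul C.g
    refine (h1.sub h2).congr (ae_of_all _ fun x => ?_)
    simp only [Pi.sub_apply]
    ring
  have hii := (intervalIntegrable_iff_integrableOn_Ioc_of_le C.neg_m_le_ℓ).2 hi
  have hψl : AbsolutelyContinuousOnInterval ψ (-C.m) 0 := hψ.1.mono <| by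
    rw [uIcc_of_le hm, uIcc_of_le C.neg_m_le_ℓ]
    exact Icc_subset_Icc_right hl
  have hψu : AbsolutelyContinuousOnInterval ψ 0 C.ℓ := hψ.1.mono <| by
    rw [uIcc_of_le hl, uIcc_of_le C.neg_m_le_ℓ]
    exact Icc_subset_Icc_left hm
  have hrl : AbsolutelyContinuousOnInterval C.rhoLower (-C.m) 0 :=
    absolutelyContinuousOnInterval_of_hasDerivAt hm (fun x hx => (C.rhoLower_spec hx).2) <|
      C.continuousOn_comp_rhoLower (G := fun z => -C.g * z / deriv C.lower.P z) <|
        (continuousOn_const.mul continuousOn_id).div C.lower.continuousOn_deriv_P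
          fun _ hx => (C.lower.deriv_P_pos hx).ne'
  have hru : AbsolutelyContinuousOnInterval C.rhoUpper 0 C.ℓ :=
    absolutelyContinuousOnInterval_of_hasDerivAt hl (fun x hx => (C.rhoUpper_spec hx).2) <|
      C.continuousOn_comp_rhoUpper (G := fun z => -C.g * z / deriv C.upper.P z) <|
        (continuousOn_const.mul continuousOn_id).div C.upper.continuousOn_deriv_P
          fun _ hx => (C.upper.deriv_P_pos hx).ne'
  have e1 := hrl.integral_deriv_mul_eq_sub (hψl.fun_mul hψl)
  have e2 := hru.integral_deriv_mul_eq_sub (hψu.fun_mul hψu)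
  -- At `0` the density takes its upper value, so this point is discarded when comparing with the
  -- lower branch.
  have hne : ∀ᵐ x : ℝ, x ≠ 0 := by simp [ae_iff, measure_singleton]
  have c1 : ∫ x in (-C.m)..0, C.rho0 x * (2 * ψ x * deriv ψ x - C.g * (C.dP0 x)⁻¹ * ψ x ^ 2) =
      ∫ x in (-C.m)..0, deriv C.rhoLower x * (ψ x * ψ x)
        + C.rhoLower x * deriv (fun x => ψ x * ψ x) x := by
    apply intervalIntegral.integral_congr_ae
    filter_upwards [hψl.ae_differentiableAt, hne] with x hx hx0 hxI
    rw [uIoc_of_le hm] at hxI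
    have hxneg : x < 0 := lt_of_le_of_ne hxI.2 hx0
    have hd := (hx (by rw [uIcc_of_le hm]; exact ⟨hxI.1.le, hxI.2⟩)).hasDerivAt
    rw [(hd.fun_mul hd).deriv, (C.rhoLower_spec ⟨hxI.1.le, hxI.2⟩).2.deriv, C.rho0_of_neg hxneg,
      dP0, if_pos hxneg, C.rho0_of_neg hxneg]
    ring
  have c2 : ∫ x in 0..C.ℓ, C.rho0 x * (2 * ψ x * deriv ψ x - C.g * (C.dP0 x)⁻¹ * ψ x ^ 2) =
      ∫ x in 0..C.ℓ, deriv C.rhoUpper x * (ψ x * ψ x)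
        + C.rhoUpper x * deriv (fun x => ψ x * ψ x) x := by
    apply intervalIntegral.integral_congr_ae
    filter_upwards [hψu.ae_differentiableAt] with x hx hxI
    rw [uIoc_of_le hl] at hxI
    have hd := (hx (by rw [uIcc_of_le hl]; exact ⟨hxI.1.le, hxI.2⟩)).hasDerivAt
    rw [(hd.fun_mul hd).deriv, (C.rhoUpper_spec ⟨hxI.1.le, hxI.2⟩).2.deriv,
      C.rho0_of_nonneg hxI.1.le, dP0, if_neg hxI.1.le.not_gt, C.rho0_of_nonneg hxI.1.le]
    ring
  have h0 : (0 : ℝ) ∈ uIcc (-C.m) C.ℓ := by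
    rw [uIcc_of_le C.neg_m_le_ℓ]
    exact ⟨hm, hl⟩
  rw [← intervalIntegral.integral_of_le C.neg_m_le_ℓ,
    ← intervalIntegral.integral_add_adjacent_intervals
      (hii.mono_set (uIcc_subset_uIcc_left h0)) (hii.mono_set (uIcc_subset_uIcc_right h0)),
    c1, c2, e1, e2, hψ.2.2.1, hψ.2.2.2, C.rhoLower_zero, C.rhoUpper_zero, jump]
  ring

/-- Completing the square in the inviscid energy. -/
theorem energy_zero_eq (hφ : IsH10 (-C.m) C.ℓ φ) (hψ : IsH10 (-C.m) C.ℓ ψ) (k : ℝ) :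
    C.energy k 0 φ ψ = (C.σ * k ^ 2 - C.g * C.jump) / 2 * ψ 0 ^ 2
      + 1 / 2 * ∫ x in Ioc (-C.m) C.ℓ, C.rho0 x * C.dP0 x *
        (deriv ψ x + k * φ x - C.g * (C.dP0 x)⁻¹ * ψ x) ^ 2 := by
  have hψ2 := hψ.memLp C.neg_m_le_ℓ
  have i1 : Integrable
      (fun x => C.g * (C.rho0 x * (2 * ψ x * deriv ψ x - C.g * (C.dP0 x)⁻¹ * ψ x ^ 2)))
      (volume.restrict (Ioc (-C.m) C.ℓ)) := by
    have h1 := (C.isCoeff_rho0.integrable_mul_mul hψ2 hψ.memLp_deriv).const_mul 2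
    have h2 := ((C.isCoeff_rho0.mul C.isCoeff_inv_dP0).integrable_mul_sq hψ2).const_mul C.g
    refine ((h1.sub h2).const_mul C.g).congr (ae_of_all _ fun x => ?_)
    simp only [Pi.sub_apply]
    ring
  have i2 := integrable_pressureDensity hφ hψ k
  have key : ∫ x in Ioc (-C.m) C.ℓ, C.rho0 x * C.dP0 x *
        (deriv ψ x + k * φ x - C.g * (C.dP0 x)⁻¹ * ψ x) ^ 2 =
      ∫ x in Ioc (-C.m) C.ℓ, ((C.dP0 x * C.rho0 x * (deriv ψ x + k * φ x) ^ 2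
        - 2 * C.g * C.rho0 x * k * φ x * ψ x)
        - C.g * (C.rho0 x * (2 * ψ x * deriv ψ x - C.g * (C.dP0 x)⁻¹ * ψ x ^ 2))) := by
    apply setIntegral_congr_fun measurableSet_Ioc
    intro x hx
    have := (C.dP0_pos ⟨hx.1.le, hx.2⟩).ne'
    simp only
    field_simp
    ring
  rw [key, integral_sub i2 i1, integral_const_mul, integral_rho0_mul hψ, energy_eq hφ hψ]
  ring

theorem integrable_rho0_mul_add (hφ : IsH10 (-C.m) C.ℓ φ) (hψ : IsH10 (-C.m) C.ℓ ψ) :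
    Integrable (fun x => C.rho0 x * (φ x ^ 2 + ψ x ^ 2)) (volume.restrict (Ioc (-C.m) C.ℓ)) := by
  simp_rw [mul_add]
  exact (C.isCoeff_rho0.integrable_mul_sq (hφ.memLp C.neg_m_le_ℓ)).add
    (C.isCoeff_rho0.integrable_mul_sq (hψ.memLp C.neg_m_le_ℓ))

theorem integrable_sq_add_sq (hφ : IsH10 (-C.m) C.ℓ φ) (hψ : IsH10 (-C.m) C.ℓ ψ) :
    Integrable (fun x => φ x ^ 2 + ψ x ^ 2) (volume.restrict (Ioc (-C.m) C.ℓ)) :=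
  (hφ.memLp C.neg_m_le_ℓ).integrable_sq.add (hψ.memLp C.neg_m_le_ℓ).integrable_sq

theorem integrable_deriv_sq_add_sq (hφ : IsH10 (-C.m) C.ℓ φ) (hψ : IsH10 (-C.m) C.ℓ ψ) :
    Integrable (fun x => deriv φ x ^ 2 + deriv ψ x ^ 2) (volume.restrict (Ioc (-C.m) C.ℓ)) :=
  hφ.memLp_deriv.integrable_sq.add hψ.memLp_deriv.integrable_sq

/-- Only the gravity term can be negative, and `2 φ ψ ≤ φ² + ψ²` bounds it by the constraint
density. -/
theorem neg_mul_J_le_energy_zero (hφ : IsH10 (-C.m) C.ℓ φ) (hψ : IsH10 (-C.m) C.ℓ ψ) {k : ℝ}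
    (hk : 0 ≤ k) : -(C.g * k) * C.J φ ψ ≤ C.energy k 0 φ ψ := by
  rw [energy_eq hφ hψ, J, intervalIntegral.integral_of_le C.neg_m_le_ℓ]
  have h : ∫ x in Ioc (-C.m) C.ℓ, -(C.g * k) * (C.rho0 x * (φ x ^ 2 + ψ x ^ 2)) ≤
      ∫ x in Ioc (-C.m) C.ℓ, (C.dP0 x * C.rho0 x * (deriv ψ x + k * φ x) ^ 2
        - 2 * C.g * C.rho0 x * k * φ x * ψ x) := by
    refine setIntegral_mono_on ((integrable_rho0_mul_add hφ hψ).const_mul _)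
      (integrable_pressureDensity hφ hψ k) measurableSet_Ioc fun x hx => ?_
    have hr := C.rho0_pos ⟨hx.1.le, hx.2⟩
    have hd := C.dP0_pos ⟨hx.1.le, hx.2⟩
    have h1 : 0 ≤ C.dP0 x * C.rho0 x * (deriv ψ x + k * φ x) ^ 2 := by positivity
    have h2 : 0 ≤ C.g * k * C.rho0 x * (φ x - ψ x) ^ 2 :=
      mul_nonneg (mul_nonneg (mul_nonneg C.g_pos.le hk) hr.le) (sq_nonneg _)
    linarith
  rw [integral_const_mul] at h
  have h3 : 0 ≤ C.σ * k ^ 2 / 2 * ψ 0 ^ 2 := by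
    have := C.σ_nonneg
    positivity
  linarith

theorem viscousEnergy_nonneg (k : ℝ) (φ ψ : ℝ → ℝ) : 0 ≤ C.viscousEnergy k φ ψ := by
  refine mul_nonneg (by norm_num) (setIntegral_nonneg measurableSet_Ioc fun x hx => ?_)
  have h1 := C.bulk0_nonneg ⟨hx.1.le, hx.2⟩
  have h2 := C.visc0_pos ⟨hx.1.le, hx.2⟩
  unfold viscousDensity
  positivity

/-- The bulk and divergence terms are dropped. Expanding the two remaining squares leaves the cross
term `-2k (φ ψ)'`, which integrates to zero by the boundary conditions once the viscosity is
replaced by its constant lower bound. -/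
theorem le_viscousEnergy (hφ : IsH10 (-C.m) C.ℓ φ) (hψ : IsH10 (-C.m) C.ℓ ψ) (k : ℝ) {d : ℝ}
    (hd : 0 ≤ d) (hvisc : ∀ x ∈ Icc (-C.m) C.ℓ, d ≤ C.visc0 x) :
    d / 2 * ((∫ x in Ioc (-C.m) C.ℓ, (deriv φ x ^ 2 + deriv ψ x ^ 2))
      + k ^ 2 * ∫ x in Ioc (-C.m) C.ℓ, (φ x ^ 2 + ψ x ^ 2)) ≤ C.viscousEnergy k φ ψ := by
  have i1 := integrable_deriv_sq_add_sq hφ hψ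
  have i2 := (integrable_sq_add_sq hφ hψ).const_mul (k ^ 2)
  have i3 : Integrable (fun x => 2 * k * (deriv φ x * ψ x + φ x * deriv ψ x))
      (volume.restrict (Ioc (-C.m) C.ℓ)) :=
    ((hφ.memLp_deriv.integrable_mul (hψ.memLp C.neg_m_le_ℓ)).add
      ((hφ.memLp C.neg_m_le_ℓ).integrable_mul hψ.memLp_deriv)).const_mul (2 * k)
  have h : ∫ x in Ioc (-C.m) C.ℓ, d * ((deriv φ x ^ 2 + deriv ψ x ^ 2)
      + k ^ 2 * (φ x ^ 2 + ψ x ^ 2) - 2 * k * (deriv φ x * ψ x + φ x * deriv ψ x)) ≤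
      ∫ x in Ioc (-C.m) C.ℓ, C.viscousDensity k φ ψ x := by
    refine setIntegral_mono_on (((i1.add i2).sub i3).const_mul d)
      (integrable_viscousDensity hφ hψ k) measurableSet_Ioc fun x hx => ?_
    have h1 := C.bulk0_nonneg ⟨hx.1.le, hx.2⟩
    have h2 := hvisc x ⟨hx.1.le, hx.2⟩
    have h3 : 0 ≤ C.bulk0 x * (deriv ψ x + k * φ x) ^ 2 := by positivity
    have h4 : d * ((deriv φ x - k * ψ x) ^ 2 + (deriv ψ x - k * φ x) ^ 2
        + 1 / 3 * (deriv ψ x + k * φ x) ^ 2) ≤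
        C.visc0 x * ((deriv φ x - k * ψ x) ^ 2 + (deriv ψ x - k * φ x) ^ 2
        + 1 / 3 * (deriv ψ x + k * φ x) ^ 2) := mul_le_mul_of_nonneg_right h2 (by positivity)
    have h5 : 0 ≤ d * (1 / 3 * (deriv ψ x + k * φ x) ^ 2) := by positivity
    unfold viscousDensity
    linarith
  have i12 : Integrable (fun x => deriv φ x ^ 2 + deriv ψ x ^ 2 + k ^ 2 * (φ x ^ 2 + ψ x ^ 2))
      (volume.restrict (Ioc (-C.m) C.ℓ)) := i1.add i2
  rw [integral_const_mul, integral_sub i12 i3, integral_add i1 i2, integral_const_mul,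
    integral_const_mul, hφ.integral_deriv_mul_add C.neg_m_le_ℓ hψ] at h
  rw [viscousEnergy]
  linarith

end Integrable

end Configuration

/-! ### Coercivity and dependence of the energy on the frequency -/

theorem sq_add_mul_sub_le (a b : ℝ) {k k' K : ℝ} (hk : k ∈ Icc 0 K) (hk' : k' ∈ Icc 0 K) :
    |(a + k' * b) ^ 2 - (a + k * b) ^ 2| ≤ |k' - k| * (1 + 2 * K) * (a ^ 2 + b ^ 2) := by
  have e : (a + k' * b) ^ 2 - (a + k * b) ^ 2 = (k' - k) * (2 * a * b + (k' + k) * b ^ 2) := by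
    ring
  have h1 : |2 * a * b| ≤ a ^ 2 + b ^ 2 := abs_le.2
    ⟨by linarith [sq_nonneg (a + b)], by linarith [sq_nonneg (a - b)]⟩
  have h2 : |(k' + k) * b ^ 2| ≤ 2 * K * (a ^ 2 + b ^ 2) := by
    have h0 : 0 ≤ (k' + k) * b ^ 2 := 
      mul_nonneg (by linarith [hk.1, hk'.1]) (sq_nonneg b)
    rw [abs_of_nonneg h0]
    exact mul_le_mul (by linarith [hk.2, hk'.2]) (by linarith [sq_nonneg a]) (sq_nonneg b)
      (by linarith [hk.1, hk.2])
  rw [e, abs_mul, mul_assoc |k' - k|]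
  refine mul_le_mul_of_nonneg_left ?_ (abs_nonneg _)
  linarith [abs_add_le (2 * a * b) ((k' + k) * b ^ 2)]

namespace Configuration

variable (C : Configuration)

/-- The squared `L²` norm of the derivatives. -/
noncomputable def gradSq (φ ψ : ℝ → ℝ) : ℝ :=
  ∫ x in Ioc (-C.m) C.ℓ, (deriv φ x ^ 2 + deriv ψ x ^ 2)

/-- The squared `L²` norm. -/
noncomputable def massSq (φ ψ : ℝ → ℝ) : ℝ :=
  ∫ x in Ioc (-C.m) C.ℓ, (φ x ^ 2 + ψ x ^ 2)

theorem gradSq_nonneg (φ ψ : ℝ → ℝ) : 0 ≤ C.gradSq φ ψ :=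
  integral_nonneg fun _ => by positivity

variable {C} {φ ψ : ℝ → ℝ}

theorem zero_mem_Icc : (0 : ℝ) ∈ Icc (-C.m) C.ℓ := ⟨C.neg_m_le, C.ℓ_pos.le⟩

theorem trace_sq_le (hφ : IsH10 (-C.m) C.ℓ φ) (hψ : IsH10 (-C.m) C.ℓ ψ) {η : ℝ} (hη : 0 < η) :
    ψ 0 ^ 2 ≤ η * C.gradSq φ ψ + η⁻¹ * C.massSq φ ψ := by
  refine (hψ.sq_le zero_mem_Icc hη).trans (add_le_add ?_ ?_)
  · refine mul_le_mul_of_nonneg_left ?_ hη.le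
    exact integral_mono hψ.memLp_deriv.integrable_sq (integrable_deriv_sq_add_sq hφ hψ)
      fun x => by simp only; linarith [sq_nonneg (deriv φ x)]
  · refine mul_le_mul_of_nonneg_left ?_ (inv_pos.2 hη).le
    exact integral_mono (hψ.memLp C.neg_m_le_ℓ).integrable_sq (integrable_sq_add_sq hφ hψ)
      fun x => by simp only; linarith [sq_nonneg (φ x)]

theorem mul_massSq_le_J (hφ : IsH10 (-C.m) C.ℓ φ) (hψ : IsH10 (-C.m) C.ℓ ψ) {d : ℝ}
    (hd : ∀ x ∈ Icc (-C.m) C.ℓ, d ≤ C.rho0 x) : d * C.massSq φ ψ ≤ 2 * C.J φ ψ := by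
  rw [J, intervalIntegral.integral_of_le C.neg_m_le_ℓ, massSq, ← integral_const_mul d]
  have := setIntegral_mono_on ((integrable_sq_add_sq hφ hψ).const_mul d)
    (integrable_rho0_mul_add hφ hψ) measurableSet_Ioc fun x hx =>
      mul_le_mul_of_nonneg_right (hd x ⟨hx.1.le, hx.2⟩)
        (add_nonneg (sq_nonneg (φ x)) (sq_nonneg (ψ x)))
  linarith

theorem J_le_mul_massSq (hφ : IsH10 (-C.m) C.ℓ φ) (hψ : IsH10 (-C.m) C.ℓ ψ) {d : ℝ}
    (hd : ∀ x ∈ Icc (-C.m) C.ℓ, C.rho0 x ≤ d) : 2 * C.J φ ψ ≤ d * C.massSq φ ψ := by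
  rw [J, intervalIntegral.integral_of_le C.neg_m_le_ℓ, massSq, ← integral_const_mul d]
  have := setIntegral_mono_on (integrable_rho0_mul_add hφ hψ)
    ((integrable_sq_add_sq hφ hψ).const_mul d) measurableSet_Ioc fun x hx =>
      mul_le_mul_of_nonneg_right (hd x ⟨hx.1.le, hx.2⟩)
        (add_nonneg (sq_nonneg (φ x)) (sq_nonneg (ψ x)))
  linarith

variable (C) in
theorem exists_massSq_bounds : ∃ m₁ m₂ : ℝ, 0 < m₁ ∧ 0 < m₂ ∧ ∀ p ∈ C.admissible,
    m₁ ≤ C.massSq p.1 p.2 ∧ C.massSq p.1 p.2 ≤ m₂ := by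
  obtain ⟨d, hd, hdr⟩ := C.exists_pos_le_rho0
  obtain ⟨-, D, -, hDr⟩ := C.isCoeff_rho0
  have hD : 0 < D := by
    have h1 := hdr 0 zero_mem_Icc
    have h2 := hDr 0 zero_mem_Icc
    exact (hd.trans_le h1).trans_le ((le_abs_self _).trans h2)
  refine ⟨2 / D, 2 / d, by positivity, by positivity, ?_⟩
  rintro ⟨φ, ψ⟩ ⟨hφ, hψ, hJ⟩
  have h1 := mul_massSq_le_J hφ hψ hdr
  have h2 := J_le_mul_massSq hφ hψ fun x hx => (le_abs_self _).trans (hDr x hx)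
  simp only at hJ
  rw [hJ] at h1 h2
  constructor
  · rw [div_le_iff₀ hD]
    linarith
  · rw [le_div_iff₀ hd]
    linarith

variable (C) in
/-- Coercivity of the energy on the admissible set. -/
theorem exists_le_energy : ∃ A B c : ℝ, 0 < A ∧ 0 < B ∧ 0 < c ∧ ∀ k s : ℝ, 0 < s →
    ∀ p ∈ C.admissible, c * s * C.gradSq p.1 p.2 + B * s * k ^ 2
      - A * (C.g * C.jump - C.σ * k ^ 2) ^ 2 / s ≤ C.energy k s p.1 p.2 := by
  obtain ⟨m₁, m₂, hm₁, hm₂, hm⟩ := C.exists_massSq_bounds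
  obtain ⟨d, hd, hdv⟩ := C.exists_pos_le_visc0
  refine ⟨m₂ / d, d / 2 * m₁, d / 4, by positivity, by positivity, by positivity, ?_⟩
  rintro k s hs ⟨φ, ψ⟩ hp
  obtain ⟨hM1, hM2⟩ := hm _ hp
  obtain ⟨hφ, hψ, hJ⟩ := hp
  simp only at hφ hψ hM1 hM2 ⊢
  have hV : d / 2 * (C.gradSq φ ψ + k ^ 2 * C.massSq φ ψ) ≤ C.viscousEnergy k φ ψ :=
    le_viscousEnergy hφ hψ k hd.le hdv
  have hsq : 0 ≤ ∫ x in Ioc (-C.m) C.ℓ, C.rho0 x * C.dP0 x *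
        (deriv ψ x + k * φ x - C.g * (C.dP0 x)⁻¹ * ψ x) ^ 2 :=
    setIntegral_nonneg measurableSet_Ioc fun x hx =>
      mul_nonneg (mul_nonneg (C.rho0_pos ⟨hx.1.le, hx.2⟩).le (C.dP0_pos ⟨hx.1.le, hx.2⟩).le)
        (sq_nonneg _)
  rw [energy_eq_add hφ hψ, energy_zero_eq hφ hψ]
  have hN := C.gradSq_nonneg φ ψ
  set a := C.g * C.jump - C.σ * k ^ 2 with ha
  have hsV : s * (d / 2 * (C.gradSq φ ψ + k ^ 2 * C.massSq φ ψ)) ≤ s * C.viscousEnergy k φ ψ :=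
    mul_le_mul_of_nonneg_left hV hs.le
  have hk : s * (d / 2 * (k ^ 2 * m₁)) ≤ s * (d / 2 * (k ^ 2 * C.massSq φ ψ)) := by gcongr
  -- The interface term is absorbed into half of the viscous gradient term. The value `η = s d /
  -- (2|a|)` in the trace inequality achieves exactly this; `a = 0` is separate because `η` divides
  -- by `|a|`.
  have key : |a| / 2 * ψ 0 ^ 2 ≤ s * d / 4 * C.gradSq φ ψ + m₂ / d * a ^ 2 / s := by
    rcases eq_or_ne a 0 with h0 | h0
    · rw [h0]
      simp
      positivity
    · have h1 : 0 < |a| := abs_pos.2 h0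
      have h2 := trace_sq_le hφ hψ (η := s * d / (2 * |a|)) (by positivity)
      calc |a| / 2 * ψ 0 ^ 2 ≤ |a| / 2 * (s * d / (2 * |a|) * C.gradSq φ ψ
            + (s * d / (2 * |a|))⁻¹ * C.massSq φ ψ) := by gcongr
        _ = s * d / 4 * C.gradSq φ ψ + C.massSq φ ψ / d * |a| ^ 2 / s := by
            field_simp
            ring
        _ ≤ _ := by
            rw [sq_abs]
            gcongr
  have h3 : -(|a| / 2 * ψ 0 ^ 2) ≤ (C.σ * k ^ 2 - C.g * C.jump) / 2 * ψ 0 ^ 2 := by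
    have : -|a| ≤ C.σ * k ^ 2 - C.g * C.jump := by
      have := le_abs_self a
      rw [ha] at this ⊢
      linarith
    have := mul_le_mul_of_nonneg_right this (sq_nonneg (ψ 0))
    linarith
  linarith

/-- The energy depends continuously on the frequency. -/
theorem exists_energy_le_add (C : Configuration) (s K : ℝ) : ∃ D, 0 ≤ D ∧
    ∀ k ∈ Icc 0 K, ∀ k' ∈ Icc 0 K, ∀ φ ψ : ℝ → ℝ, IsH10 (-C.m) C.ℓ φ → IsH10 (-C.m) C.ℓ ψ →
      C.energy k' s φ ψ ≤
        C.energy k s φ ψ + D * |k' - k| * (C.gradSq φ ψ + C.massSq φ ψ) := by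
  -- The three coefficients multiply `(ψ' + kφ)²`, each of the other two viscous squares, and the
  -- gravity coupling, respectively.
  have hα : IsCoeff (-C.m) C.ℓ
      fun x => C.dP0 x * C.rho0 x + (s * C.bulk0 x + s / 3 * C.visc0 x) :=
    (C.isCoeff_dP0.mul C.isCoeff_rho0).add (((IsCoeff.const _ _ s).mul C.isCoeff_bulk0).add
      ((IsCoeff.const _ _ (s / 3)).mul C.isCoeff_visc0))
  have hβ : IsCoeff (-C.m) C.ℓ fun x => s * C.visc0 x :=
    (IsCoeff.const _ _ s).mul C.isCoeff_visc0
  have hγ : IsCoeff (-C.m) C.ℓ fun x => C.g * C.rho0 x :=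
    (IsCoeff.const _ _ C.g).mul C.isCoeff_rho0
  obtain ⟨-, Mα, hMα, hα⟩ := hα
  obtain ⟨-, Mβ, hMβ, hβ⟩ := hβ
  obtain ⟨-, Mγ, hMγ, hγ⟩ := hγ
  rcases lt_or_ge K 0 with hK | hK
  · exact ⟨0, le_rfl, fun k hk => absurd (hk.1.trans hk.2) hK.not_ge⟩
  set L := 1 + 2 * K with hL
  have hLpos : 0 ≤ L := by positivity
  have hσ := C.σ_nonneg
  refine ⟨C.σ * L + (Mα * L + 2 * (Mβ * L) + Mγ) / 2, by positivity, ?_⟩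
  intro k hk k' hk' φ ψ hφ hψ
  have iT : ∀ k, Integrable (fun x => (C.dP0 x * C.rho0 x * (deriv ψ x + k * φ x) ^ 2
        - 2 * C.g * C.rho0 x * k * φ x * ψ x) + s * C.viscousDensity k φ ψ x)
        (volume.restrict (Ioc (-C.m) C.ℓ)) := fun k =>
    (integrable_pressureDensity hφ hψ k).add ((integrable_viscousDensity hφ hψ k).const_mul s)
  have hE : ∀ k, C.energy k s φ ψ = C.σ * k ^ 2 / 2 * ψ 0 ^ 2 + 1 / 2 *
      ∫ x in Ioc (-C.m) C.ℓ, ((C.dP0 x * C.rho0 x * (deriv ψ x + k * φ x) ^ 2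
        - 2 * C.g * C.rho0 x * k * φ x * ψ x) + s * C.viscousDensity k φ ψ x) := by
    intro k
    rw [energy_eq hφ hψ, integral_add (integrable_pressureDensity hφ hψ k)
      ((integrable_viscousDensity hφ hψ k).const_mul s), integral_const_mul, viscousEnergy]
    ring
  have iS : Integrable (fun x => (deriv φ x ^ 2 + deriv ψ x ^ 2) + (φ x ^ 2 + ψ x ^ 2))
      (volume.restrict (Ioc (-C.m) C.ℓ)) :=
    (integrable_deriv_sq_add_sq hφ hψ).add (integrable_sq_add_sq hφ hψ)
  have hS : ∫ x in Ioc (-C.m) C.ℓ, ((deriv φ x ^ 2 + deriv ψ x ^ 2) + (φ x ^ 2 + ψ x ^ 2)) =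
      C.gradSq φ ψ + C.massSq φ ψ :=
    integral_add (integrable_deriv_sq_add_sq hφ hψ) (integrable_sq_add_sq hφ hψ)
  have hpt : ∫ x in Ioc (-C.m) C.ℓ, ((C.dP0 x * C.rho0 x * (deriv ψ x + k' * φ x) ^ 2
        - 2 * C.g * C.rho0 x * k' * φ x * ψ x) + s * C.viscousDensity k' φ ψ x) ≤
      ∫ x in Ioc (-C.m) C.ℓ, (((C.dP0 x * C.rho0 x * (deriv ψ x + k * φ x) ^ 2
        - 2 * C.g * C.rho0 x * k * φ x * ψ x) + s * C.viscousDensity k φ ψ x) +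
        |k' - k| * (Mα * L + 2 * (Mβ * L) + Mγ) *
          ((deriv φ x ^ 2 + deriv ψ x ^ 2) + (φ x ^ 2 + ψ x ^ 2))) := by
    refine setIntegral_mono_on (iT k') ((iT k).add (iS.const_mul _)) measurableSet_Ioc
      fun x hx => ?_
    have hx' : x ∈ Icc (-C.m) C.ℓ := ⟨hx.1.le, hx.2⟩
    set S := (deriv φ x ^ 2 + deriv ψ x ^ 2) + (φ x ^ 2 + ψ x ^ 2) with hSdef
    have q1 := sq_nonneg (deriv φ x)
    have q2 := sq_nonneg (deriv ψ x)
    have q3 := sq_nonneg (φ x)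
    have q4 := sq_nonneg (ψ x)
    have hSnn : 0 ≤ S := by positivity
    have hdk : 0 ≤ |k' - k| * L := mul_nonneg (abs_nonneg _) hLpos
    have t1 : |(deriv ψ x + k' * φ x) ^ 2 - (deriv ψ x + k * φ x) ^ 2| ≤ |k' - k| * L * S :=
      (sq_add_mul_sub_le _ _ hk hk').trans (mul_le_mul_of_nonneg_left (by linarith) hdk)
    -- The minus sign is put on `φ`, so that the estimate for nonnegative frequencies applies.
    have t2 : |(deriv ψ x + k' * -φ x) ^ 2 - (deriv ψ x + k * -φ x) ^ 2| ≤ |k' - k| * L * S :=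
      (sq_add_mul_sub_le _ _ hk hk').trans
        (mul_le_mul_of_nonneg_left (by rw [neg_sq]; linarith) hdk)
    have t3 : |(deriv φ x + k' * -ψ x) ^ 2 - (deriv φ x + k * -ψ x) ^ 2| ≤ |k' - k| * L * S :=
      (sq_add_mul_sub_le _ _ hk hk').trans
        (mul_le_mul_of_nonneg_left (by rw [neg_sq]; linarith) hdk)
    have t4 : |-(k' - k) * (2 * φ x * ψ x)| ≤ |k' - k| * S := by
      rw [abs_mul, abs_neg]
      refine mul_le_mul_of_nonneg_left (abs_le.2 ⟨?_, ?_⟩) (abs_nonneg _)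
      · linarith [sq_nonneg (φ x + ψ x)]
      · linarith [sq_nonneg (φ x - ψ x)]
    have bd : ∀ {u v U V : ℝ}, |u| ≤ U → |v| ≤ V → u * v ≤ U * V := fun {u v U V} hu hv =>
      (le_abs_self _).trans ((abs_mul u v).le.trans
        (mul_le_mul hu hv (abs_nonneg _) ((abs_nonneg _).trans hu)))
    have b1 := bd (hα x hx') t1
    have b2 := bd (hβ x hx') t2
    have b3 := bd (hβ x hx') t3
    have b4 := bd (hγ x hx') t4
    unfold viscousDensity
    linarith
  rw [integral_add (iT k) (iS.const_mul _), integral_const_mul, hS] at hpt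
  have hsurf : C.σ * k' ^ 2 / 2 * ψ 0 ^ 2 ≤ C.σ * k ^ 2 / 2 * ψ 0 ^ 2 +
      C.σ * L * |k' - k| * (C.gradSq φ ψ + C.massSq φ ψ) := by
    have h1 := trace_sq_le hφ hψ one_pos
    rw [inv_one, one_mul, one_mul] at h1
    have h2 := (le_abs_self _).trans (sq_add_mul_sub_le 0 1 hk hk')
    norm_num at h2
    have h3 : (k' ^ 2 - k ^ 2) * ψ 0 ^ 2 ≤
        |k' - k| * L * (C.gradSq φ ψ + C.massSq φ ψ) :=
      (mul_le_mul_of_nonneg_right (sub_le_iff_le_add.2 (by linarith)) (sq_nonneg _)).trans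
        (mul_le_mul_of_nonneg_left h1 (mul_nonneg (abs_nonneg _) hLpos))
    have h4 : 0 ≤ |k' - k| * L * (C.gradSq φ ψ + C.massSq φ ψ) :=
      mul_nonneg (mul_nonneg (abs_nonneg _) hLpos) ((sq_nonneg _).trans h1)
    have h5 := mul_le_mul_of_nonneg_left h3 hσ
    have h6 := mul_nonneg hσ h4
    linarith
  rw [hE k, hE k']
  linarith

end Configuration

/-! ### Test functions concentrating the inviscid energy on the interface -/

namespace Configuration

variable (C : Configuration)

/-- The quotient of a piecewise defined function by the steady density. -/
noncomputable def divRho (ul uu : ℝ → ℝ) (x : ℝ) : ℝ :=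
  if x < 0 then ul x / C.rhoLower x else uu x / C.rhoUpper x

section DivRho

variable {C} {ul uu ul' uu' : ℝ → ℝ}

theorem hasDerivAt_div_rhoLower {x : ℝ} (hx : x ∈ Icc (-C.m) 0)
    (hu : HasDerivAt ul (ul' x) x) : HasDerivAt (fun y => ul y / C.rhoLower y)
      ((ul' x + C.g * ul x / deriv C.lower.P (C.rhoLower x)) / C.rhoLower x) x := by
  obtain ⟨h1, h2⟩ := C.rhoLower_spec hx
  have h3 := C.lower.deriv_P_pos h1
  have h4 : (ul' x + C.g * ul x / deriv C.lower.P (C.rhoLower x)) / C.rhoLower x =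
      (ul' x * C.rhoLower x - ul x * (-C.g * C.rhoLower x / deriv C.lower.P (C.rhoLower x))) /
        C.rhoLower x ^ 2 := by
    field_simp
    ring
  rw [h4]
  exact hu.fun_div h2 h1.ne'

theorem hasDerivAt_div_rhoUpper {x : ℝ} (hx : x ∈ Icc 0 C.ℓ)
    (hu : HasDerivAt uu (uu' x) x) : HasDerivAt (fun y => uu y / C.rhoUpper y)
      ((uu' x + C.g * uu x / deriv C.upper.P (C.rhoUpper x)) / C.rhoUpper x) x := by
  obtain ⟨h1, h2⟩ := C.rhoUpper_spec hx
  have h3 := C.upper.deriv_P_pos h1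
  have h4 : (uu' x + C.g * uu x / deriv C.upper.P (C.rhoUpper x)) / C.rhoUpper x =
      (uu' x * C.rhoUpper x - uu x * (-C.g * C.rhoUpper x / deriv C.upper.P (C.rhoUpper x))) /
        C.rhoUpper x ^ 2 := by
    field_simp
    ring
  rw [h4]
  exact hu.fun_div h2 h1.ne'

theorem isH10_divRho (hul : ∀ x, HasDerivAt ul (ul' x) x) (hul' : Continuous ul')
    (huu : ∀ x, HasDerivAt uu (uu' x) x) (huu' : Continuous uu')
    (h0 : ul 0 / C.rhoMinus = uu 0 / C.rhoPlus) (hm : ul (-C.m) = 0) (hℓ : uu C.ℓ = 0) :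
    IsH10 (-C.m) C.ℓ (C.divRho ul uu) := by
  have cl : Continuous ul := continuous_iff_continuousAt.2 fun x => (hul x).continuousAt
  have cu : Continuous uu := continuous_iff_continuousAt.2 fun x => (huu x).continuousAt
  refine isH10_ite (neg_lt_zero.2 C.m_pos) C.ℓ_pos
    (fun x hx => hasDerivAt_div_rhoLower hx (hul x)) ?_
    (fun x hx => hasDerivAt_div_rhoUpper hx (huu x)) ?_ ?_ (by simp [hm]) (by simp [hℓ])
  · refine ContinuousOn.div (hul'.continuousOn.add (ContinuousOn.div
      (cl.const_mul _).continuousOn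
      (C.continuousOn_comp_rhoLower C.lower.continuousOn_deriv_P)
      fun x hx => (C.lower.deriv_P_pos (C.rhoLower_spec hx).1).ne'))
      (C.continuousOn_comp_rhoLower continuousOn_id) fun x hx => (C.rhoLower_spec hx).1.ne'
  · refine ContinuousOn.div (huu'.continuousOn.add (ContinuousOn.div
      (cu.const_mul _).continuousOn
      (C.continuousOn_comp_rhoUpper C.upper.continuousOn_deriv_P)
      fun x hx => (C.upper.deriv_P_pos (C.rhoUpper_spec hx).1).ne'))
      (C.continuousOn_comp_rhoUpper continuousOn_id) fun x hx => (C.rhoUpper_spec hx).1.ne'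
  · rwa [C.rhoLower_zero, C.rhoUpper_zero]

/-- Here `1/ρ₀` acts as an integrating factor: by hydrostatic balance, the operator `ψ ↦ ψ' - g ψ /
P'(ρ₀)` becomes plain differentiation of the numerator. -/
theorem deriv_divRho_sub (hul : ∀ x, HasDerivAt ul (ul' x) x)
    (huu : ∀ x, HasDerivAt uu (uu' x) x) {x : ℝ} (hx : x ∈ Icc (-C.m) C.ℓ) (hx0 : x ≠ 0) :
    deriv (C.divRho ul uu) x - C.g * (C.dP0 x)⁻¹ * C.divRho ul uu x = C.divRho ul' uu' x := by
  rcases lt_or_gt_of_ne hx0 with h | h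
  · have hxl : x ∈ Icc (-C.m) 0 := ⟨hx.1, h.le⟩
    have e : deriv (C.divRho ul uu) x = _ :=
      (deriv_ite_of_neg h).trans (hasDerivAt_div_rhoLower hxl (hul x)).deriv
    rw [e, divRho, divRho, if_pos h, if_pos h, dP0, if_pos h, C.rho0_of_neg h]
    ring
  · have hxu : x ∈ Icc 0 C.ℓ := ⟨h.le, hx.2⟩
    have e : deriv (C.divRho ul uu) x = _ :=
      (deriv_ite_of_pos h).trans (hasDerivAt_div_rhoUpper hxu (huu x)).deriv
    rw [e, divRho, divRho, if_neg h.le.not_gt, if_neg h.le.not_gt, dP0, if_neg h.le.not_gt,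
      C.rho0_of_nonneg h.le]
    ring

end DivRho

variable {C}

theorem J_pos {φ ψ : ℝ → ℝ} (hφ : IsH10 (-C.m) C.ℓ φ) (hψ : IsH10 (-C.m) C.ℓ ψ) (h0 : ψ 0 ≠ 0) :
    0 < C.J φ ψ := by
  obtain ⟨d, hd, hdr⟩ := C.exists_pos_le_rho0
  have h1 := mul_massSq_le_J hφ hψ hdr
  suffices 0 < C.massSq φ ψ by
    have := mul_pos hd this
    linarith
  by_contra! hM
  have hN := C.gradSq_nonneg φ ψ
  have hpos : 0 < ψ 0 ^ 2 := by positivity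
  -- With this `η` the gradient contributes at most half of `ψ(0)²`; the `+ 1` avoids division by
  -- zero.
  have h2 := trace_sq_le hφ hψ (η := ψ 0 ^ 2 / (2 * (C.gradSq φ ψ + 1))) (by positivity)
  have h3 : (ψ 0 ^ 2 / (2 * (C.gradSq φ ψ + 1)))⁻¹ * C.massSq φ ψ ≤ 0 :=
    mul_nonpos_of_nonneg_of_nonpos (by positivity) hM
  have h4 : ψ 0 ^ 2 / (2 * (C.gradSq φ ψ + 1)) * C.gradSq φ ψ ≤ ψ 0 ^ 2 / 2 := by
    rw [div_mul_eq_mul_div, div_le_div_iff₀ (by positivity) (by positivity)]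
    nlinarith
  linarith

variable (C) in
/-- Test functions for which the inviscid energy is concentrated on the interface. -/
theorem exists_energy_zero_eq {k : ℝ} (hk : 0 < k) : ∃ p ∈ C.admissible, ∃ t, 0 < t ∧
    C.energy k 0 p.1 p.2 = (C.σ * k ^ 2 - C.g * C.jump) / 2 * t := by
  -- Numerator with value `r` and slope `0` at the interface and a double zero at `±t`. With `r` the
  -- one-sided density, both `q/ρ₀` and `q'/ρ₀` are continuous across `0` and vanish at the walls.
  let q : ℝ → ℝ → ℝ → ℝ := fun r t x => r * (1 - (x / t) ^ 2) ^ 2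
  let q' : ℝ → ℝ → ℝ → ℝ := fun r t x => r * (2 * (1 - (x / t) ^ 2) * -(2 * (x / t) * (1 / t)))
  let q'' : ℝ → ℝ → ℝ → ℝ := fun r t x => r * (2 * -(2 * (x / t) * (1 / t)) *
    -(2 * (x / t) * (1 / t)) + 2 * (1 - (x / t) ^ 2) * -(2 * (1 / t) * (1 / t)))
  have hbase : ∀ t x : ℝ, HasDerivAt (fun x => 1 - (x / t) ^ 2) (-(2 * (x / t) * (1 / t))) x := by
    intro t x
    simpa using (((hasDerivAt_id x).div_const t).pow 2).const_sub 1
  have hq : ∀ r t x, HasDerivAt (q r t) (q' r t x) x := fun r t x => by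
    simpa [q, q'] using ((hbase t x).pow 2).const_mul r
  have hq' : ∀ r t x, HasDerivAt (q' r t) (q'' r t x) x := fun r t x => by
    have h1 : HasDerivAt (fun x => -(2 * (x / t) * (1 / t))) (-(2 * (1 / t) * (1 / t))) x := by
      simpa using ((((hasDerivAt_id x).div_const t).const_mul 2).mul_const (1 / t)).fun_neg
    exact ((((hbase t x).const_mul 2).mul h1).const_mul r)
  have cq' : ∀ r t, Continuous (q' r t) := fun r t => by fun_prop
  have cq'' : ∀ r t, Continuous (q'' r t) := fun r t => by fun_prop
  have hr := C.rhoMinus_pos.ne'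
  have hR := C.rhoPlus_pos.ne'
  have hm := C.m_pos.ne'
  have hℓ := C.ℓ_pos.ne'
  have hψ : IsH10 (-C.m) C.ℓ (C.divRho (q C.rhoMinus C.m) (q C.rhoPlus C.ℓ)) :=
    isH10_divRho (hq _ _) (cq' _ _) (hq _ _) (cq' _ _) (by simp [q, hr, hR])
      (by simp [q, hm]) (by simp [q, hℓ])
  have hθ : IsH10 (-C.m) C.ℓ (C.divRho (q' C.rhoMinus C.m) (q' C.rhoPlus C.ℓ)) :=
    isH10_divRho (hq' _ _) (cq'' _ _) (hq' _ _) (cq'' _ _) (by simp [q'])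
      (by simp [q', hm]) (by simp [q', hℓ])
  set ψ := C.divRho (q C.rhoMinus C.m) (q C.rhoPlus C.ℓ) with hψdef
  set θ := C.divRho (q' C.rhoMinus C.m) (q' C.rhoPlus C.ℓ) with hθdef
  have hψ0 : ψ 0 = 1 := by
    simp [hψdef, divRho, q, C.rhoUpper_zero, hR]
  -- The choice `φ = -θ/k` makes `ψ' + kφ - gψ/P'(ρ₀)` vanish off the interface; scaling by `c` then
  -- enforces `J = 1`.
  have hφ := hθ.const_mul (-k⁻¹)
  have hJ := J_pos hφ hψ (by rw [hψ0]; exact one_ne_zero)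
  set c := (√(C.J (fun x => -k⁻¹ * θ x) ψ))⁻¹ with hc
  have hc0 : 0 < c := inv_pos.2 (Real.sqrt_pos.2 hJ)
  refine ⟨(fun x => c * (-k⁻¹ * θ x), fun x => c * ψ x),
    ⟨hφ.const_mul c, hψ.const_mul c, ?_⟩, c ^ 2, by positivity, ?_⟩
  · have : C.J (fun x => c * (-k⁻¹ * θ x)) (fun x => c * ψ x) =
        c ^ 2 * C.J (fun x => -k⁻¹ * θ x) ψ := by
      simp only [J]
      rw [mul_left_comm, ← intervalIntegral.integral_const_mul (c ^ 2)]
      congr 2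
      ext x
      ring
    rw [this, hc, inv_pow, Real.sq_sqrt hJ.le, inv_mul_cancel₀ hJ.ne']
  · rw [energy_zero_eq (hφ.const_mul c) (hψ.const_mul c), hψ0]
    have hne : ∀ᵐ x : ℝ, x ≠ 0 := by simp [ae_iff, measure_singleton]
    have hz : ∫ x in Ioc (-C.m) C.ℓ, C.rho0 x * C.dP0 x *
        (deriv (fun x => c * ψ x) x + k * (c * (-k⁻¹ * θ x))
          - C.g * (C.dP0 x)⁻¹ * (c * ψ x)) ^ 2 = 0 := by
      refine integral_eq_zero_of_ae ?_
      filter_upwards [ae_restrict_mem measurableSet_Ioc, ae_restrict_of_ae hne] with x hx hx0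
      have h1 := deriv_divRho_sub (hq C.rhoMinus C.m) (hq C.rhoPlus C.ℓ) ⟨hx.1.le, hx.2⟩ hx0
      have h2 : deriv (fun x => c * ψ x) x = c * deriv ψ x := deriv_const_mul_field c
      have h3 : deriv (fun x => c * ψ x) x + k * (c * (-k⁻¹ * θ x))
          - C.g * (C.dP0 x)⁻¹ * (c * ψ x) = 0 := by
        rw [h2, show k * (c * (-k⁻¹ * θ x)) = -c * θ x by field_simp]
        rw [← hψdef, ← hθdef] at h1
        rw [← h1]
        ring
      rw [h3]
      simp
    rw [hz]
    ring

end Configuration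

/-! ### The infimum `μ` as a function of viscosity and frequency -/

theorem tendsto_zero_of_pow_le {α : Type*} {l : Filter α} {f h : α → ℝ} (n : ℕ)
    (hf : ∀ᶠ x in l, 0 ≤ f x ∧ f x ^ n ≤ h x) (hh : Tendsto h l (𝓝 0)) : Tendsto f l (𝓝 0) := by
  refine tendsto_order.2 ⟨fun a ha => ?_, fun a ha => ?_⟩
  · filter_upwards [hf] with x hx using ha.trans_le hx.1
  · filter_upwards [hf, (tendsto_order.1 hh).2 (a ^ n) (pow_pos ha n)] with x hx hx'
    exact lt_of_pow_lt_pow_left₀ n ha.le (hx.2.trans_lt hx')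

namespace Configuration

variable (C : Configuration)

theorem mem_unstableFreqs_iff {k : ℝ} :
    k ∈ C.unstableFreqs ↔ 0 < k ∧ C.σ * k ^ 2 < C.g * C.jump := by
  refine and_congr_right fun hk => ?_
  rcases C.σ_nonneg.eq_or_lt with h | h
  · simp [← h, mul_pos C.g_pos C.jump_pos]
  · rw [criticalFreq, Real.lt_sqrt hk.le, lt_div_iff₀ h, mul_comm]
    simp [h]

variable {C} {k s : ℝ} {p : (ℝ → ℝ) × (ℝ → ℝ)}

theorem neg_mul_le_energy (hk : 0 ≤ k) (hs : 0 ≤ s) (hp : p ∈ C.admissible) :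
    -(C.g * k) ≤ C.energy k s p.1 p.2 := by
  obtain ⟨hφ, hψ, hJ⟩ := hp
  have h1 := neg_mul_J_le_energy_zero hφ hψ hk
  rw [hJ, mul_one] at h1
  rw [energy_eq_add hφ hψ]
  exact h1.trans (le_add_of_nonneg_right (mul_nonneg hs (viscousEnergy_nonneg _ _ _)))

theorem mu_le (hk : 0 ≤ k) (hs : 0 ≤ s) (hp : p ∈ C.admissible) :
    C.mu k s ≤ C.energy k s p.1 p.2 := by
  refine csInf_le ⟨-(C.g * k), ?_⟩ (mem_image_of_mem _ hp)
  rintro _ ⟨q, hq, rfl⟩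
  exact neg_mul_le_energy hk hs hq

theorem le_mu {b : ℝ} (h : ∀ p ∈ C.admissible, b ≤ C.energy k s p.1 p.2) : b ≤ C.mu k s := by
  -- The admissible set does not depend on `k`, so the test pair at frequency `1` shows it nonempty;
  -- `sInf ∅ = 0` would not respect the lower bound.
  obtain ⟨p, hp, -⟩ := C.exists_energy_zero_eq one_pos
  refine le_csInf ⟨_, mem_image_of_mem _ hp⟩ ?_
  rintro _ ⟨q, hq, rfl⟩
  exact h q hq

theorem neg_mul_le_mu (hk : 0 ≤ k) (hs : 0 ≤ s) : -(C.g * k) ≤ C.mu k s :=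
  le_mu fun _ hp => neg_mul_le_energy hk hs hp

theorem mu_mono (hk : 0 ≤ k) {t : ℝ} (hs : 0 ≤ s) (hst : s ≤ t) : C.mu k s ≤ C.mu k t := by
  refine le_mu fun p hp => (mu_le hk hs hp).trans ?_
  rw [energy_eq_add hp.1 hp.2.1 k s, energy_eq_add hp.1 hp.2.1 k t]
  gcongr
  exact viscousEnergy_nonneg _ _ _

/-- An infimum of affine functions of `s` is concave; continuity on the open half-line follows. -/
theorem concaveOn_mu (hk : 0 ≤ k) : ConcaveOn ℝ (Ioi 0) (C.mu k) := by
  refine ⟨convex_Ioi 0, fun s hs t ht a b ha hb hab => le_mu fun p hp => ?_⟩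
  have h1 := mul_le_mul_of_nonneg_left (mu_le hk (le_of_lt hs) hp) ha
  have h2 := mul_le_mul_of_nonneg_left (mu_le hk (le_of_lt ht) hp) hb
  have h3 : C.energy k (a • s + b • t) p.1 p.2 =
      a * C.energy k s p.1 p.2 + b * C.energy k t p.1 p.2 := by
    rw [energy_eq_add hp.1 hp.2.1 k s, energy_eq_add hp.1 hp.2.1 k t, energy_eq_add hp.1 hp.2.1,
      smul_eq_mul, smul_eq_mul]
    linear_combination (-C.energy k 0 p.1 p.2) * hab
  rw [h3]
  exact add_le_add h1 h2

theorem continuousOn_mu (hk : 0 ≤ k) : ContinuousOn (C.mu k) (Ioi 0) :=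
  (concaveOn_mu hk).continuousOn isOpen_Ioi

variable (C) in
theorem exists_le_mu : ∃ A B : ℝ, 0 < A ∧ 0 < B ∧ ∀ k s : ℝ, 0 < s →
    B * s * k ^ 2 - A * (C.g * C.jump - C.σ * k ^ 2) ^ 2 / s ≤ C.mu k s := by
  obtain ⟨A, B, c, hA, hB, hc, h⟩ := C.exists_le_energy
  refine ⟨A, B, hA, hB, fun k s hs => le_mu fun p hp => le_trans ?_ (h k s hs p hp)⟩
  have := mul_nonneg (mul_nonneg hc.le hs.le) (C.gradSq_nonneg p.1 p.2)
  linarith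

theorem exists_mu_le_add (hk : k ∈ C.unstableFreqs) :
    ∃ α V, 0 < α ∧ 0 ≤ V ∧ ∀ s, 0 ≤ s → C.mu k s ≤ -α + s * V := by
  obtain ⟨hk0, hk1⟩ := C.mem_unstableFreqs_iff.1 hk
  obtain ⟨p, hp, t, ht, he⟩ := C.exists_energy_zero_eq hk0
  refine ⟨(C.g * C.jump - C.σ * k ^ 2) / 2 * t, C.viscousEnergy k p.1 p.2,
    mul_pos (by linarith) ht, viscousEnergy_nonneg _ _ _, fun s hs => ?_⟩
  refine (mu_le hk0.le hs hp).trans ?_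
  rw [energy_eq_add hp.1 hp.2.1, he]
  linarith

variable (C) in
-- Changing `k` costs a multiple of the `H¹` norm, and coercivity bounds that norm by the energy
-- itself. The resulting estimate is multiplicative, so no minimiser is needed. Exchanging `k` and
-- `k'` gives the reverse bound.
theorem exists_mu_le_mul_add (hs : 0 < s) (K : ℝ) : ∃ D₁ D₂, 0 ≤ D₁ ∧ 0 ≤ D₂ ∧
    ∀ k ∈ Icc 0 K, ∀ k' ∈ Icc 0 K,
      C.mu k' s ≤ C.mu k s * (1 + D₁ * |k' - k|) + D₂ * |k' - k| := by
  obtain ⟨A, B, c, hA, hB, hc, hle⟩ := C.exists_le_energy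
  obtain ⟨m₁, m₂, hm₁, hm₂, hm⟩ := C.exists_massSq_bounds
  obtain ⟨D, hD, hadd⟩ := C.exists_energy_le_add s K
  have hσ := C.σ_nonneg
  have hgj := mul_pos C.g_pos C.jump_pos
  set Q := A * (C.g * C.jump + C.σ * K ^ 2) ^ 2 / s with hQ
  have hQ0 : 0 ≤ Q := by positivity
  refine ⟨D * (1 / (c * s)), D * (Q / (c * s) + m₂), by positivity, by positivity, ?_⟩
  intro k hk k' hk'
  have hpos : 0 < 1 + D * (1 / (c * s)) * |k' - k| := by positivity
  -- Solving for `μ k s` turns the claim into a lower bound for an infimum, which can be checked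
  -- pair by pair.
  rw [← sub_le_iff_le_add, ← div_le_iff₀ hpos]
  refine le_mu fun p hp => ?_
  rw [div_le_iff₀ hpos, sub_le_iff_le_add]
  refine (mu_le hk'.1 hs.le hp).trans ((hadd k hk k' hk' _ _ hp.1 hp.2.1).trans ?_)
  have h1 := hle k s hs p hp
  have h2 := (hm p hp).2
  have h3 : A * (C.g * C.jump - C.σ * k ^ 2) ^ 2 / s ≤ Q := by
    rw [hQ]
    have hkK : C.σ * k ^ 2 ≤ C.σ * K ^ 2 := by
      have := pow_le_pow_left₀ hk.1 hk.2 2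
      gcongr
    have hk0 : 0 ≤ C.σ * k ^ 2 := by positivity
    have : (C.g * C.jump - C.σ * k ^ 2) ^ 2 ≤ (C.g * C.jump + C.σ * K ^ 2) ^ 2 :=
      sq_le_sq' (by linarith) (by linarith)
    gcongr
  have h4 : C.gradSq p.1 p.2 ≤ C.energy k s p.1 p.2 * (1 / (c * s)) + Q / (c * s) := by
    rw [mul_one_div, ← add_div, le_div_iff₀ (by positivity)]
    have : 0 ≤ B * s * k ^ 2 := by positivity
    linarith
  have h5 := mul_le_mul_of_nonneg_left (add_le_add h4 h2) (mul_nonneg hD (abs_nonneg (k' - k)))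
  linarith

theorem tendsto_mu (hs : 0 < s) {k₀ : ℝ} (hk₀ : 0 < k₀) :
    Tendsto (fun k => C.mu k s) (𝓝 k₀) (𝓝 (C.mu k₀ s)) := by
  obtain ⟨D₁, D₂, hD₁, hD₂, h⟩ := C.exists_mu_le_mul_add hs (k₀ + 1)
  have hmem₀ : k₀ ∈ Icc 0 (k₀ + 1) := ⟨hk₀.le, by linarith⟩
  have hmem : ∀ᶠ k in 𝓝 k₀, k ∈ Icc 0 (k₀ + 1) := Icc_mem_nhds hk₀ (by linarith)
  have hd : Tendsto (fun k => |k - k₀|) (𝓝 k₀) (𝓝 0) := by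
    have : Continuous fun k => |k - k₀| := by fun_prop
    simpa using this.tendsto k₀
  have hup : Tendsto (fun k => C.mu k₀ s * (1 + D₁ * |k - k₀|) + D₂ * |k - k₀|) (𝓝 k₀)
      (𝓝 (C.mu k₀ s)) := by
    simpa using (((hd.const_mul D₁).const_add 1).const_mul (C.mu k₀ s)).add (hd.const_mul D₂)
  have hlow : Tendsto (fun k => (C.mu k₀ s - D₂ * |k - k₀|) / (1 + D₁ * |k - k₀|)) (𝓝 k₀)
      (𝓝 (C.mu k₀ s)) := by
    have := ((hd.const_mul D₂).const_sub (C.mu k₀ s)).div ((hd.const_mul D₁).const_add 1)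
      (by simp)
    simpa [Pi.div_def] using this
  refine tendsto_of_tendsto_of_tendsto_of_le_of_le' hlow hup ?_ ?_
  · filter_upwards [hmem] with k hk
    have h1 := h k hk k₀ hmem₀
    rw [abs_sub_comm] at h1
    rw [div_le_iff₀ (by positivity)]
    linarith
  · filter_upwards [hmem] with k hk using h k₀ hmem₀ k hk

/-! ### The fixed point equation -/

theorem isGrowthRate_iff : C.IsGrowthRate k s ↔ 0 < s ∧ s ^ 2 + C.mu k s = 0 := by
  constructor
  · rintro ⟨h1, h2, h3⟩
    refine ⟨h1, ?_⟩
    have := Real.sq_sqrt (show 0 ≤ -C.mu k s by linarith)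
    rw [← h3] at this
    linarith
  · rintro ⟨h1, h2⟩
    have h3 : -C.mu k s = s ^ 2 := by linarith
    refine ⟨h1, by linarith [pow_pos h1 2], ?_⟩
    rw [h3, Real.sqrt_sq h1.le]

theorem sq_add_mu_strictMonoOn (hk : 0 ≤ k) :
    StrictMonoOn (fun s => s ^ 2 + C.mu k s) (Ioi 0) := fun _ hs _ _ hst =>
  add_lt_add_of_lt_of_le (pow_lt_pow_left₀ hst (le_of_lt hs) two_ne_zero)
    (mu_mono hk (le_of_lt hs) hst.le)

theorem existsUnique_isGrowthRate (hk : k ∈ C.unstableFreqs) : ∃! s, C.IsGrowthRate k s := by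
  have hk0 := hk.1.le
  obtain ⟨α, V, hα, hV, h⟩ := exists_mu_le_add hk
  have hgk := mul_nonneg C.g_pos.le hk0
  -- Then `a² ≤ a` and `a (1 + V) ≤ α/2`, so `a² + μ(a) ≤ -α/2`.
  set a := min 1 (α / (2 * (1 + V))) with ha
  have ha0 : 0 < a := lt_min one_pos (by positivity)
  have hfa : a ^ 2 + C.mu k a ≤ 0 := by
    have h1 := h a ha0.le
    have h2 : a ^ 2 ≤ a := by
      have : a ≤ 1 := min_le_left _ _
      nlinarith
    have h3 : a * (1 + V) ≤ α / 2 := by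
      have : a ≤ α / (2 * (1 + V)) := min_le_right _ _
      rw [le_div_iff₀ (by positivity)] at this
      linarith
    linarith
  -- Large enough that `b² ≥ g k ≥ -μ(b)`.
  set b := 1 + C.g * k with hb
  have hab : a ≤ b := (min_le_left _ _).trans (by linarith)
  have hfb : 0 ≤ b ^ 2 + C.mu k b := by
    have := neg_mul_le_mu (C := C) hk0 (s := b) (by linarith)
    have : b ^ 2 = 1 + 2 * (C.g * k) + (C.g * k) ^ 2 := by rw [hb]; ring
    nlinarith [sq_nonneg (C.g * k)]
  have hcont : ContinuousOn (fun s => s ^ 2 + C.mu k s) (Icc a b) :=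
    (continuous_pow 2).continuousOn.add
      ((continuousOn_mu hk0).mono fun x hx => ha0.trans_le hx.1)
  obtain ⟨s, hs, hfs⟩ := intermediate_value_Icc hab hcont ⟨hfa, hfb⟩
  have hs0 : 0 < s := ha0.trans_le hs.1
  refine ⟨s, isGrowthRate_iff.2 ⟨hs0, hfs⟩, fun t ht => ?_⟩
  obtain ⟨ht0, hft⟩ := isGrowthRate_iff.1 ht
  exact (sq_add_mu_strictMonoOn hk0).injOn ht0 hs0 (hft.trans hfs.symm)

theorem isGrowthRate_growthRate (hk : k ∈ C.unstableFreqs) : C.IsGrowthRate k (C.growthRate k) :=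
  Classical.epsilon_spec (existsUnique_isGrowthRate hk).exists

theorem growthRate_pos (hk : k ∈ C.unstableFreqs) : 0 < C.growthRate k :=
  (isGrowthRate_growthRate hk).1

theorem growthRate_sq (hk : k ∈ C.unstableFreqs) :
    C.growthRate k ^ 2 = -C.mu k (C.growthRate k) := by
  linarith [(isGrowthRate_iff.1 (isGrowthRate_growthRate hk)).2]

theorem growthRate_sq_le (hk : k ∈ C.unstableFreqs) : C.growthRate k ^ 2 ≤ C.g * k := by
  rw [growthRate_sq hk]
  linarith [neg_mul_le_mu (C := C) hk.1.le (growthRate_pos hk).le]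

/-! ### Bounds, continuity and limits of the growth rate -/

variable (C) in
-- Insert `s = λ` and `μ = -λ²` into the lower bound for `μ` and multiply by `λ`. The cubic bound
-- controls the critical frequency, the other one `k → ∞`.
theorem exists_growthRate_le : ∃ A B : ℝ, 0 < A ∧ 0 < B ∧ ∀ k ∈ C.unstableFreqs,
    C.growthRate k ^ 3 ≤ A * (C.g * C.jump - C.σ * k ^ 2) ^ 2 ∧
      C.growthRate k ^ 2 * k ^ 2 ≤ B := by
  obtain ⟨A, B, hA, hB, h⟩ := C.exists_le_mu
  have hgj := mul_pos C.g_pos C.jump_pos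
  refine ⟨A, A * (C.g * C.jump) ^ 2 / B, hA, by positivity, fun k hk => ?_⟩
  have hpos := growthRate_pos hk
  have h1 := h k _ hpos
  have h2 := growthRate_sq hk
  set r := C.growthRate k
  have h3 : B * (r ^ 2 * k ^ 2) + r ^ 3 ≤ A * (C.g * C.jump - C.σ * k ^ 2) ^ 2 := by
    have h4 : (B * r * k ^ 2 + r ^ 2) ≤ A * (C.g * C.jump - C.σ * k ^ 2) ^ 2 / r := by linarith
    rw [le_div_iff₀ hpos] at h4
    linarith
  have h5 : 0 ≤ B * (r ^ 2 * k ^ 2) := by positivity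
  refine ⟨by linarith, ?_⟩
  rw [le_div_iff₀ hB]
  have h6 : (C.g * C.jump - C.σ * k ^ 2) ^ 2 ≤ (C.g * C.jump) ^ 2 := by
    have := (C.mem_unstableFreqs_iff.1 hk).2
    have h7 : 0 ≤ C.σ * k ^ 2 := mul_nonneg C.σ_nonneg (sq_nonneg k)
    exact pow_le_pow_left₀ (by linarith) (by linarith) 2
  have h8 := mul_le_mul_of_nonneg_left h6 hA.le
  have h9 := pow_pos hpos 3
  linarith

variable (C) in
theorem exists_growthRate_le_const : ∃ M, ∀ k ∈ C.unstableFreqs, C.growthRate k ≤ M := by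
  obtain ⟨A, B, hA, hB, h⟩ := C.exists_growthRate_le
  refine ⟨C.g + B + 1, fun k hk => ?_⟩
  have h1 := growthRate_sq_le hk
  have h2 := (h k hk).2
  have hk0 := hk.1
  have hg := C.g_pos
  have hr := growthRate_pos hk
  set r := C.growthRate k
  -- For `k ≤ 1` use `λ² ≤ g k`; for `k ≥ 1` use `λ² k² ≤ B`.
  have h3 : r ^ 2 ≤ C.g + B := by
    rcases le_total k 1 with h4 | h4
    · nlinarith
    · nlinarith [one_le_pow₀ h4 (n := 2), sq_nonneg r]
  nlinarith [sq_nonneg (r - 1)]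

variable (C) in
theorem isOpen_unstableFreqs : IsOpen C.unstableFreqs := by
  have : C.unstableFreqs = {k | 0 < k} ∩ {k | C.σ * k ^ 2 < C.g * C.jump} := by
    ext k
    exact C.mem_unstableFreqs_iff
  rw [this]
  exact (isOpen_lt continuous_const continuous_id).inter
    (isOpen_lt (by fun_prop) continuous_const)

variable (C) in
-- The sign of `s² + μ(s)` tells whether `s` lies below or above `λ(k)`. At a fixed `s ≠ λ(k₀)` that
-- strict sign persists for `k` near `k₀`, so continuity of `μ` in `k` alone suffices.
theorem continuousOn_growthRate : ContinuousOn C.growthRate C.unstableFreqs := by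
  intro k₀ hk₀
  refine ContinuousAt.continuousWithinAt (tendsto_order.2 ⟨fun a ha => ?_, fun b hb => ?_⟩)
  · obtain ⟨s, hs, hsk⟩ := exists_between (max_lt ha (growthRate_pos hk₀))
    obtain ⟨has, hs0⟩ := max_lt_iff.1 hs
    have h1 : s ^ 2 + C.mu k₀ s < 0 := by
      rw [← (isGrowthRate_iff.1 (isGrowthRate_growthRate hk₀)).2]
      exact sq_add_mu_strictMonoOn hk₀.1.le hs0 (growthRate_pos hk₀) hsk
    have h2 := (tendsto_mu (C := C) hs0 hk₀.1).const_add (s ^ 2)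
    filter_upwards [C.isOpen_unstableFreqs.mem_nhds hk₀, (tendsto_order.1 h2).2 _ h1]
      with k hk hk'
    rw [← (isGrowthRate_iff.1 (isGrowthRate_growthRate hk)).2] at hk'
    exact has.trans (((sq_add_mu_strictMonoOn hk.1.le).lt_iff_lt hs0 (growthRate_pos hk)).1 hk')
  · obtain ⟨s, hs, hsb⟩ := exists_between hb
    have hs0 := (growthRate_pos hk₀).trans hs
    have h1 : 0 < s ^ 2 + C.mu k₀ s := by
      rw [← (isGrowthRate_iff.1 (isGrowthRate_growthRate hk₀)).2]
      exact sq_add_mu_strictMonoOn hk₀.1.le (growthRate_pos hk₀) hs0 hs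
    have h2 := (tendsto_mu (C := C) hs0 hk₀.1).const_add (s ^ 2)
    filter_upwards [C.isOpen_unstableFreqs.mem_nhds hk₀, (tendsto_order.1 h2).1 _ h1]
      with k hk hk'
    rw [← (isGrowthRate_iff.1 (isGrowthRate_growthRate hk)).2] at hk'
    exact (((sq_add_mu_strictMonoOn hk.1.le).lt_iff_lt (growthRate_pos hk) hs0).1 hk').trans hsb

variable (C) in
theorem criticalFreq_pos (hσ : 0 < C.σ) : 0 < C.criticalFreq :=
  Real.sqrt_pos.2 (div_pos (mul_pos C.g_pos C.jump_pos) hσ)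

variable (C) in
theorem tendsto_growthRate_zero : Tendsto C.growthRate (𝓝[>] 0) (𝓝 0) := by
  refine tendsto_zero_of_pow_le 2 (h := fun k => C.g * k) ?_ ?_
  · have h1 : ∀ᶠ k : ℝ in 𝓝 0, C.σ * k ^ 2 < C.g * C.jump := by
      have : Continuous fun k : ℝ => C.σ * k ^ 2 := by fun_prop
      exact this.continuousAt.eventually_lt_const (by simpa using mul_pos C.g_pos C.jump_pos)
    filter_upwards [self_mem_nhdsWithin, nhdsWithin_le_nhds h1] with k hk hk'
    have hk := C.mem_unstableFreqs_iff.2 ⟨hk, hk'⟩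
    exact ⟨(growthRate_pos hk).le, growthRate_sq_le hk⟩
  · have : Continuous fun k => C.g * k := by fun_prop
    simpa using (this.tendsto 0).mono_left nhdsWithin_le_nhds

variable (C) in
theorem tendsto_growthRate_criticalFreq (hσ : 0 < C.σ) :
    Tendsto C.growthRate (𝓝[<] C.criticalFreq) (𝓝 0) := by
  obtain ⟨A, B, -, -, h⟩ := C.exists_growthRate_le
  refine tendsto_zero_of_pow_le 3
    (h := fun k => A * (C.g * C.jump - C.σ * k ^ 2) ^ 2) ?_ ?_
  · filter_upwards [self_mem_nhdsWithin,
      nhdsWithin_le_nhds (Ioi_mem_nhds (C.criticalFreq_pos hσ))] with k hk hk'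
    have hk : k ∈ C.unstableFreqs := ⟨hk', fun _ => hk⟩
    exact ⟨(growthRate_pos hk).le, (h k hk).1⟩
  · have h1 : Continuous fun k => A * (C.g * C.jump - C.σ * k ^ 2) ^ 2 := by fun_prop
    have h2 : C.σ * C.criticalFreq ^ 2 = C.g * C.jump := by
      rw [criticalFreq, Real.sq_sqrt (div_pos (mul_pos C.g_pos C.jump_pos) hσ).le]
      field_simp
    simpa [h2] using (h1.tendsto C.criticalFreq).mono_left nhdsWithin_le_nhds

variable (C) in
theorem tendsto_growthRate_atTop (hσ : C.σ = 0) : Tendsto C.growthRate atTop (𝓝 0) := by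
  obtain ⟨A, B, -, -, h⟩ := C.exists_growthRate_le
  refine tendsto_zero_of_pow_le 2 (h := fun k => B / k ^ 2) ?_ ?_
  · filter_upwards [eventually_gt_atTop 0] with k hk
    have hk' : k ∈ C.unstableFreqs := ⟨hk, fun h => absurd hσ h.ne'⟩
    refine ⟨(growthRate_pos hk').le, ?_⟩
    rw [le_div_iff₀ (by positivity)]
    exact (h k hk').2
  · exact tendsto_const_nhds.div_atTop (tendsto_pow_atTop two_ne_zero)

/-! ### Attainment of the maximal growth rates -/

/-- The frequencies at which the growth rate is bounded below lie in a compact set of unstable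
frequencies. -/
theorem exists_compact_of_le_growthRate {r : ℝ} (hr : 0 < r) : ∃ S ⊆ C.unstableFreqs,
    IsCompact S ∧ ∀ k ∈ C.unstableFreqs, r ≤ C.growthRate k → k ∈ S := by
  obtain ⟨A, B, hA, hB, h⟩ := C.exists_growthRate_le
  have hg := C.g_pos
  -- The three constraints come from `λ² ≤ g k`, `λ² k² ≤ B` and `λ³ ≤ A (g ⟦ρ₀⟧ - σ k²)²`; they
  -- keep `k` away from `0`, from infinity and from the critical frequency.
  refine ⟨Icc (r ^ 2 / C.g) (√(B / r ^ 2)) ∩ {k | √(r ^ 3 / A) ≤ C.g * C.jump - C.σ * k ^ 2},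
    ?_, ?_, ?_⟩
  · rintro k ⟨hk, hk'⟩
    have h1 : 0 < r ^ 2 / C.g := by positivity
    have h2 : 0 < √(r ^ 3 / A) := Real.sqrt_pos.2 (by positivity)
    have h3 : √(r ^ 3 / A) ≤ C.g * C.jump - C.σ * k ^ 2 := hk'
    exact C.mem_unstableFreqs_iff.2 ⟨h1.trans_le hk.1, by linarith⟩
  · exact isCompact_Icc.inter_right (isClosed_le continuous_const (by fun_prop))
  · intro k hk hrk
    have hk0 := hk.1
    have hlt := (C.mem_unstableFreqs_iff.1 hk).2
    have h2 := pow_le_pow_left₀ hr.le hrk 2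
    have h3 := pow_le_pow_left₀ hr.le hrk 3
    refine ⟨⟨?_, ?_⟩, ?_⟩
    · rw [div_le_iff₀ hg]
      linarith [growthRate_sq_le hk]
    · refine Real.le_sqrt_of_sq_le ?_
      rw [le_div_iff₀ (by positivity), mul_comm]
      exact (mul_le_mul_of_nonneg_right h2 (sq_nonneg k)).trans (h k hk).2
    · refine (Real.sqrt_le_left (by linarith)).2 ?_
      rw [div_le_iff₀ hA, mul_comm]
      exact h3.trans (h k hk).1

variable (C) in
theorem exists_mem_unstableFreqs : ∃ k, k ∈ C.unstableFreqs := by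
  rcases C.σ_nonneg.eq_or_lt with h | h
  · exact ⟨1, one_pos, fun h' => absurd h h'.ne⟩
  · obtain ⟨k, h1, h2⟩ := exists_between (C.criticalFreq_pos h)
    exact ⟨k, h1, fun _ => h2⟩

variable (C) in
theorem exists_isMaxOn_growthRate :
    ∃ k ∈ C.unstableFreqs, ∀ k' ∈ C.unstableFreqs, C.growthRate k' ≤ C.growthRate k := by
  obtain ⟨k₁, hk₁⟩ := C.exists_mem_unstableFreqs
  obtain ⟨S, hS, hSc, hmem⟩ := exists_compact_of_le_growthRate (growthRate_pos hk₁)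
  obtain ⟨k, hk, hmax⟩ := hSc.exists_isMaxOn ⟨k₁, hmem k₁ hk₁ le_rfl⟩
    (C.continuousOn_growthRate.mono hS)
  refine ⟨k, hS hk, fun k' hk' => ?_⟩
  rcases le_total (C.growthRate k₁) (C.growthRate k') with h | h
  · exact hmax (hmem k' hk' h)
  · exact h.trans (hmax (hmem k₁ hk₁ le_rfl))

variable (C) in
theorem maxRate_spec : 0 < C.maxRate ∧ IsGreatest C.rates C.maxRate := by
  obtain ⟨k, hk, hmax⟩ := C.exists_isMaxOn_growthRate
  have hnorm : ‖EuclideanSpace.single (0 : Fin 2) k‖ = k := by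
    rw [PiLp.norm_single, Real.norm_of_nonneg hk.1.le]
  have hg : IsGreatest C.rates (C.growthRate k) := by
    refine ⟨⟨EuclideanSpace.single 0 k, by rwa [hnorm], by rw [hnorm]⟩, ?_⟩
    rintro _ ⟨ξ, hξ, rfl⟩
    exact hmax _ hξ
  rw [maxRate, hg.csSup_eq]
  exact ⟨growthRate_pos hk, hg⟩

theorem finite_lattice_inter_closedBall {L : ℝ} (hL : 0 < L) (R : ℝ) :
    {ξ : EuclideanSpace ℝ (Fin 2) | (∀ i, ∃ n : ℤ, ξ i = L⁻¹ * n) ∧ ‖ξ‖ ≤ R}.Finite := by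
  refine ((Set.finite_Icc (fun _ : Fin 2 => -⌈L * R⌉) (fun _ => ⌈L * R⌉)).image
    fun n => WithLp.toLp 2 fun i => L⁻¹ * (n i : ℝ)).subset ?_
  rintro ξ ⟨hξ, hR⟩
  choose n hn using hξ
  have hb : ∀ i, |n i| ≤ ⌈L * R⌉ := fun i => by
    have h1 : |ξ i| ≤ R := (PiLp.norm_apply_le ξ i).trans hR
    rw [hn i, abs_mul, abs_of_pos (inv_pos.2 hL), inv_mul_le_iff₀ hL] at h1
    have h2 := h1.trans (Int.le_ceil (L * R))
    rw [← Int.cast_abs] at h2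
    exact Int.cast_le.1 h2
  refine ⟨n, ⟨fun i => (abs_le.1 (hb i)).1, fun i => (abs_le.1 (hb i)).2⟩, ?_⟩
  ext i
  exact (hn i).symm

theorem maxRatePeriodic_spec {L : ℝ} (hL : 0 < L) (hLσ : √(C.σ / (C.g * C.jump)) < L) :
    0 < C.maxRatePeriodic L ∧ IsGreatest (C.ratesPeriodic L) (C.maxRatePeriodic L) := by
  have hgj := mul_pos C.g_pos C.jump_pos
  -- The condition on `L` says precisely that the shortest nonzero lattice vectors, of length `1/L`,
  -- are unstable.
  have hL1 : L⁻¹ ∈ C.unstableFreqs := by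
    refine C.mem_unstableFreqs_iff.2 ⟨inv_pos.2 hL, ?_⟩
    rw [Real.sqrt_lt' hL, div_lt_iff₀ hgj] at hLσ
    rw [inv_pow, ← div_eq_mul_inv, div_lt_iff₀ (by positivity)]
    linarith
  have hnorm : ‖EuclideanSpace.single (0 : Fin 2) L⁻¹‖ = L⁻¹ := by
    rw [PiLp.norm_single, Real.norm_of_nonneg (inv_pos.2 hL).le]
  obtain ⟨S, -, hSc, hmem⟩ := exists_compact_of_le_growthRate (growthRate_pos hL1)
  obtain ⟨R, hR⟩ := hSc.isBounded.exists_norm_le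
  -- Only lattice frequencies at least as unstable as `1/L` compete; they lie in a bounded set, so
  -- there are finitely many and no continuity is needed.
  set T := {ξ : EuclideanSpace ℝ (Fin 2) | (∀ i, ∃ n : ℤ, ξ i = L⁻¹ * n) ∧
    ‖ξ‖ ∈ C.unstableFreqs ∧ C.growthRate L⁻¹ ≤ C.growthRate ‖ξ‖} with hT
  have hTfin : T.Finite := (finite_lattice_inter_closedBall hL R).subset fun ξ hξ =>
    ⟨hξ.1, by simpa using hR _ (hmem _ hξ.2.1 hξ.2.2)⟩
  have hT1 : EuclideanSpace.single (0 : Fin 2) L⁻¹ ∈ T := by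
    refine ⟨fun i => ?_, by rwa [hnorm], by rw [hnorm]⟩
    by_cases hi : i = 0
    · exact ⟨1, by simp [hi]⟩
    · exact ⟨0, by simp [hi]⟩
  obtain ⟨ξ, hξ, hmax⟩ := Set.exists_max_image T (fun ξ => C.growthRate ‖ξ‖) hTfin ⟨_, hT1⟩
  have hg : IsGreatest (C.ratesPeriodic L) (C.growthRate ‖ξ‖) := by
    refine ⟨⟨ξ, hξ.1, hξ.2.1, rfl⟩, ?_⟩
    rintro _ ⟨ζ, hζ, hζu, rfl⟩
    rcases le_total (C.growthRate L⁻¹) (C.growthRate ‖ζ‖) with h | h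
    · exact hmax ζ ⟨hζ, hζu, h⟩
    · exact h.trans hξ.2.2
  rw [maxRatePeriodic, hg.csSup_eq]
  exact ⟨growthRate_pos hξ.2.1, hg⟩

end Configuration

end RayleighTaylor

theorem mainTheorem3 (C : RayleighTaylor.Configuration) :
    -- the growth rate is well defined and positive on the unstable frequencies
    (∀ k ∈ C.unstableFreqs, (∃! s, C.IsGrowthRate k s) ∧ C.IsGrowthRate k (C.growthRate k)) ∧
    (∀ k ∈ C.unstableFreqs, 0 < C.growthRate k) ∧
    -- boundedness and continuity
    (∃ M, ∀ k ∈ C.unstableFreqs, C.growthRate k ≤ M) ∧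
    ContinuousOn C.growthRate C.unstableFreqs ∧
    -- limits at both ends
    Tendsto C.growthRate (𝓝[>] 0) (𝓝 0) ∧
    (0 < C.σ → Tendsto C.growthRate (𝓝[<] C.criticalFreq) (𝓝 0)) ∧
    (C.σ = 0 → Tendsto C.growthRate atTop (𝓝 0)) ∧
    -- the maximal growth rates are positive and attained
    (0 < C.maxRate ∧ IsGreatest C.rates C.maxRate) ∧
    (∀ L : ℝ, 0 < L → √(C.σ / (C.g * C.jump)) < L →
      0 < C.maxRatePeriodic L ∧ IsGreatest (C.ratesPeriodic L) (C.maxRatePeriodic L)) := by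
  exact ⟨fun _ hk => ⟨RayleighTaylor.Configuration.existsUnique_isGrowthRate hk,
      RayleighTaylor.Configuration.isGrowthRate_growthRate hk⟩,
    fun _ hk => RayleighTaylor.Configuration.growthRate_pos hk, C.exists_growthRate_le_const,
    C.continuousOn_growthRate, C.tendsto_growthRate_zero, C.tendsto_growthRate_criticalFreq,
    C.tendsto_growthRate_atTop, C.maxRate_spec,
    fun _ hL hLσ => RayleighTaylor.Configuration.maxRatePeriodic_spec hL hLσ⟩
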